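/- Let $n\ge 3$ and let $\mathrm{can}$ denote the canonical (round) metric of the unit sphere $\mathbb S^n$. For a Riemannian metric $g$ on a manifold $M$ define $\sigma_-(g)\colon M\to[0,\infty)$ as follows: $\sigma_-(g)(x)=0$ if all the sectional curvatures of $g$ at $x$ are nonnegative, and otherwise $-\sigma_-(g)(x)$ is the lowest sectional curvature of $g$ at $x$. Then there are an infinite closed set $\Sigma\subset\mathbb S^n$ with $\mathbb S^n\setminus\Sigma$ nonempty and connected, and a smooth function $f\colon\mathbb S^n\setminus\Sigma\to\mathbb R$, such that the conformal metric $g=e^{2f}\,\mathrm{can}$ on $\mathbb S^n\setminus\Sigma$ is complete, its sectional curvatures are bounded from below (uniformly on $\mathbb S^n\setminus\Sigma$), and $$\int_{\mathbb S^n\setminus\Sigma}\sigma_-(g)^{\frac n2}\,d\mathrm{vol}_g<\infty .$$ -/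

import Mathlib

open Bundle Set MeasureTheory Metric
open scoped Manifold ContDiff ENNReal Topology

noncomputable section

namespace RiemGeom

/-! ### Riemannian geometry in a coordinate patch

A metric in coordinates is a matrix-valued function `G` on `ℝⁿ`; `G y i j = g(∂ᵢ, ∂ⱼ)` at `y`. -/

/-- The partial derivative `∂ᵢ φ (y)` of a function on `ℝⁿ`. -/
def partialDeriv {n : ℕ} (i : Fin n) (φ : EuclideanSpace ℝ (Fin n) → ℝ)
    (y : EuclideanSpace ℝ (Fin n)) : ℝ :=
  fderiv ℝ φ y (EuclideanSpace.single i 1)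

/-- The Christoffel symbols of the Levi-Civita connection in coordinates,
`Γᵏᵢⱼ = ½ ∑ₗ gᵏˡ (∂ᵢ gⱼₗ + ∂ⱼ gᵢₗ - ∂ₗ gᵢⱼ)`. -/
def christoffel {n : ℕ} (G : EuclideanSpace ℝ (Fin n) → Matrix (Fin n) (Fin n) ℝ)
    (k i j : Fin n) (y : EuclideanSpace ℝ (Fin n)) : ℝ :=
  (1 / 2) * ∑ l, (G y)⁻¹ k l *
    (partialDeriv i (fun z => G z j l) y + partialDeriv j (fun z => G z i l) y
      - partialDeriv l (fun z => G z i j) y)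

/-- The coefficient `Rˡ` of the curvature tensor `R(∂ᵢ, ∂ⱼ)∂ₖ = ∑ₗ Rˡ ∂ₗ`, with the convention
`R(X, Y)Z = ∇_X ∇_Y Z - ∇_Y ∇_X Z - ∇_[X,Y] Z`. -/
def riemannTensor {n : ℕ} (G : EuclideanSpace ℝ (Fin n) → Matrix (Fin n) (Fin n) ℝ)
    (l i j k : Fin n) (y : EuclideanSpace ℝ (Fin n)) : ℝ :=
  partialDeriv i (christoffel G l j k) y - partialDeriv j (christoffel G l i k) y
    + ∑ m, (christoffel G l i m y * christoffel G m j k y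
      - christoffel G l j m y * christoffel G m i k y)

/-- The scalar product `g(u, v)` at `y` of two vectors given by their coordinates. -/
def coordInner {n : ℕ} (G : EuclideanSpace ℝ (Fin n) → Matrix (Fin n) (Fin n) ℝ)
    (y u v : EuclideanSpace ℝ (Fin n)) : ℝ :=
  ∑ i, ∑ j, G y i j * u i * v j

/-- The sectional curvature `g(R(u, v)v, u) / (g(u, u) g(v, v) - g(u, v)²)` at `y` of the plane
spanned by two linearly independent vectors given by their coordinates. -/
def coordSectionalCurvature {n : ℕ}
    (G : EuclideanSpace ℝ (Fin n) → Matrix (Fin n) (Fin n) ℝ)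
    (y u v : EuclideanSpace ℝ (Fin n)) : ℝ :=
  (∑ i, ∑ j, ∑ k, ∑ l, ∑ m, G y l m * riemannTensor G l i j k y * u i * v j * v k * u m) /
    (coordInner G y u u * coordInner G y v v - coordInner G y u v ^ 2)

/-! ### Riemannian geometry on a manifold without boundary -/

/-- A smooth Riemannian metric on an `n`-dimensional manifold. -/
abbrev SmoothMetric (n : ℕ) (M : Type*) [TopologicalSpace M]
    [ChartedSpace (EuclideanSpace ℝ (Fin n)) M] [IsManifold (𝓡 n) ∞ M] : Type _ :=
  ContMDiffRiemannianMetric (𝓡 n) ∞ (EuclideanSpace ℝ (Fin n))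
    (fun x : M => TangentSpace (𝓡 n) x)

section Manifold

variable {n : ℕ} {M : Type*} [TopologicalSpace M]
  [ChartedSpace (EuclideanSpace ℝ (Fin n)) M] [IsManifold (𝓡 n) ∞ M]

/-- The matrix of the metric `g` in the preferred chart at `p`, as a function of the coordinates
(meaningful on the target of that chart, an open set). -/
def metricInChart (g : SmoothMetric n M) (p : M) (y : EuclideanSpace ℝ (Fin n)) :
    Matrix (Fin n) (Fin n) ℝ :=
  Matrix.of fun i j =>
    g.inner ((extChartAt (𝓡 n) p).symm y)
      (mfderiv 𝓘(ℝ, EuclideanSpace ℝ (Fin n)) (𝓡 n) (extChartAt (𝓡 n) p).symm y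
        (EuclideanSpace.single i (1 : ℝ) : EuclideanSpace ℝ (Fin n)))
      (mfderiv 𝓘(ℝ, EuclideanSpace ℝ (Fin n)) (𝓡 n) (extChartAt (𝓡 n) p).symm y
        (EuclideanSpace.single j (1 : ℝ) : EuclideanSpace ℝ (Fin n)))

/-- The coordinates of a tangent vector at `p` in the preferred chart at `p`. -/
def tangentCoord (p : M) (u : TangentSpace (𝓡 n) p) : EuclideanSpace ℝ (Fin n) :=
  mfderiv (𝓡 n) 𝓘(ℝ, EuclideanSpace ℝ (Fin n)) (extChartAt (𝓡 n) p) p u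

/-- The sectional curvature of `g` at `p` of the plane spanned by two linearly independent tangent
vectors `u`, `v`, computed in the preferred chart at `p`. -/
def sectionalCurvature (g : SmoothMetric n M) (p : M) (u v : TangentSpace (𝓡 n) p) : ℝ :=
  coordSectionalCurvature (metricInChart g p) (extChartAt (𝓡 n) p p)
    (tangentCoord p u) (tangentCoord p v)

/-- The set of all sectional curvatures of `g` at the point `p`. -/
def sectionalCurvaturesAt (g : SmoothMetric n M) (p : M) : Set ℝ :=
  {κ | ∃ u v : TangentSpace (𝓡 n) p,
    LinearIndependent ℝ ![u, v] ∧ κ = sectionalCurvature g p u v}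

/-- The sectional curvatures of `g` are bounded from below, uniformly on the manifold. -/
def SectionalCurvatureBoundedBelow (g : SmoothMetric n M) : Prop :=
  ∃ K : ℝ, ∀ p : M, ∀ κ ∈ sectionalCurvaturesAt g p, K ≤ κ

open Classical in
/-- `σ₋(g)(p)` is `0` if all the sectional curvatures at `p` are nonnegative, and otherwise
`-σ₋(g)(p)` is the lowest sectional curvature at `p`. -/
def sigmaMinus (g : SmoothMetric n M) (p : M) : ℝ :=
  if ∀ κ ∈ sectionalCurvaturesAt g p, 0 ≤ κ then 0 else -sInf (sectionalCurvaturesAt g p)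

/-- The manifold is complete for the Riemannian distance of `g`, the infimum of the lengths of the
`C¹` paths between two points. -/
def IsCompleteMetric [RegularSpace M] (g : SmoothMetric n M) : Prop :=
  letI : RiemannianBundle (fun x : M => TangentSpace (𝓡 n) x) := ⟨g.toRiemannianMetric⟩
  haveI : IsContinuousRiemannianBundle (EuclideanSpace ℝ (Fin n))
      (fun x : M => TangentSpace (𝓡 n) x) :=
    ⟨g.inner, g.contMDiff.continuous, fun _ _ _ => rfl⟩
  letI : PseudoEMetricSpace M := PseudoEMetricSpace.ofRiemannianMetric (𝓡 n) M
  CompleteSpace M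

/-- The Riemannian volume on the domain of the preferred chart at `p`: the image under the inverse
chart of `√det(gᵢⱼ) dy`, a measure on `M` that is carried by that domain. -/
def chartVolume [MeasurableSpace M] [BorelSpace M] (g : SmoothMetric n M) (p : M) : Measure M :=
  Measure.map (extChartAt (𝓡 n) p).symm
    (((volume : Measure (EuclideanSpace ℝ (Fin n))).restrict
        (extChartAt (𝓡 n) p).target).withDensity
      fun y => ENNReal.ofReal (Real.sqrt (metricInChart g p y).det))

/-- The Riemannian volume `dvol_g` of a second countable manifold. The measures `chartVolume g p`
are the restrictions of `dvol_g` to the chart domains, which cover `M` (countably many suffice), so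
that `dvol_g` is their supremum, the least measure that is at least each of them. -/
def riemannianVolume [SecondCountableTopology M] [MeasurableSpace M] [BorelSpace M]
    (g : SmoothMetric n M) : Measure M :=
  ⨆ p : M, chartVolume g p

end Manifold

/-! ### Domains of the round sphere -/

/-- The unit sphere `Sⁿ` of `ℝⁿ⁺¹`, with Mathlib's manifold structure. -/
abbrev UnitSphere (n : ℕ) : Type := sphere (0 : EuclideanSpace ℝ (Fin (n + 1))) 1

/-- The round (canonical) metric of `Sⁿ` on an open subset `Ω`: the scalar product in `ℝⁿ⁺¹` of
the images of two tangent vectors under the differential of the inclusion. -/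
def roundMetric {n : ℕ} (Ω : TopologicalSpace.Opens (UnitSphere n)) (x : Ω)
    (u v : TangentSpace (𝓡 n) x) : ℝ :=
  let D : TangentSpace (𝓡 n) x →L[ℝ] EuclideanSpace ℝ (Fin (n + 1)) :=
    mfderiv (𝓡 n) 𝓘(ℝ, EuclideanSpace ℝ (Fin (n + 1)))
      (fun z : Ω => ((z : UnitSphere n) : EuclideanSpace ℝ (Fin (n + 1)))) x
  inner ℝ (D u) (D v)

end RiemGeom

end

/-!
The stereographic projection with pole `-q` identifies the round sphere without `-q` with `ℝⁿ`, up
to a conformal factor. A metric conformal to the round one is thus written `e^{2h} |dy|²` on a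
subset of `ℝⁿ`. The subset is the complement of a sequence of points `zᵢ` that goes to infinity fast
(`neckCentre`); on the sphere these points converge to `-q`, so that together with `-q` they form an
infinite closed set with connected complement. The exponent `h` (`neckExponent`) vanishes except in
disjoint balls around the `zᵢ`, where `h = -φᵢ(log |y - zᵢ|²)`. The profile `φᵢ` (`neckProfile`) is
concave, vanishes on `[Lᵢ, ∞)`, has slope `1/2` on `(-∞, 0]`, and `|φᵢ''| ≤ B / Lᵢ` throughout.
Hence `g` is a flat space with one cylindrical end at each `zᵢ`, and a long interpolation between
the two geometries on the annulus `1 ≤ |y - zᵢ| ≤ exp (Lᵢ / 2)`.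

*Curvature.* If `A` and `B` are quadratic polynomials for which `A⁻² |dy|²` and `B⁻² |dy|²` are
flat, the metric with exponent `-(1 - p) log A - p log B`, `p ∈ [0, 1]` constant, has nonnegative
curvature; the cylinder is the case `p = 1/2`. Hence the only negative contribution to the curvature
of the metric with exponent `-log A - φ (log B - log A)`, `0 ≤ φ' ≤ 1`, comes from `φ''`
(`le_coordSectionalCurvature_of_profile`). Since `1 - ⟨·, a⟩`, `|a| = 1`, is such a polynomial
in every stereographic chart (`one_sub_inner_invStereo`), this applies in the preferred chart at
each point, in which the sectional curvature is defined. The outcome is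
`K ≥ -4 |φᵢ''| e^{-2h} / |y - zᵢ|²` (`le_of_mem_sectionalCurvaturesAt`). As
`e^{-2h} ≤ |y - zᵢ|²`, this is bounded below.

*Integral.* The bound gives `σ₋^(n/2) dvol ≤ (4B / Lᵢ)^(n/2) |y - zᵢ|⁻ⁿ dy` on the annulus, and
`σ₋ = 0` off the annuli. The integral of `|y - zᵢ|⁻ⁿ` over the annulus is a multiple of `Lᵢ`, so
that the neck contributes at most a multiple of `Lᵢ^(1 - n/2)`. The exponent is negative because
`n ≥ 3`, and the sum over `Lᵢ = 4^(i+1)` converges. One chart covers the domain, which reduces the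
Riemannian volume to an integral over `ℝⁿ` (`lintegral_riemannianVolume_le`).

*Completeness.* The function `h + log (1 + |y|²)` is proper on the domain and has bounded gradient
for `g`, which is enough (`isCompleteMetric_of_proper`).
-/

noncomputable section

namespace RiemGeom

/-! ### Sectional curvature of a conformally flat metric in coordinates -/

section Curvature

variable {n : ℕ}

local notation "𝔼" => EuclideanSpace ℝ (Fin n)

lemma partialDeriv_congr {φ ψ : 𝔼 → ℝ} {y : 𝔼} (h : φ =ᶠ[𝓝 y] ψ) (i : Fin n) :
    partialDeriv i φ y = partialDeriv i ψ y := by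
  simp only [partialDeriv, h.fderiv_eq]

lemma partialDeriv_of_hasFDerivAt {φ : 𝔼 → ℝ} {φ' : 𝔼 →L[ℝ] ℝ} {y : 𝔼}
    (h : HasFDerivAt φ φ' y) (i : Fin n) :
    partialDeriv i φ y = φ' (EuclideanSpace.single i 1) := by
  simp only [partialDeriv, h.fderiv]

/-- The Christoffel symbols of `e^{2w} δ`, in terms of the Euclidean gradient `W` of `w`. -/
lemma christoffel_conformal {G : 𝔼 → Matrix (Fin n) (Fin n) ℝ} {w : 𝔼 → ℝ} {W z : 𝔼}
    (hG : G =ᶠ[𝓝 z] fun x => Real.exp (2 * w x) • (1 : Matrix (Fin n) (Fin n) ℝ))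
    (hw : HasFDerivAt w (innerSL ℝ W) z) (k i j : Fin n) :
    christoffel G k i j z = (1 : Matrix (Fin n) (Fin n) ℝ) k j * W i
      + (1 : Matrix (Fin n) (Fin n) ℝ) k i * W j - (1 : Matrix (Fin n) (Fin n) ℝ) i j * W k := by
  have hd : ∀ a b c : Fin n, partialDeriv a (fun x => G x b c) z
      = 2 * Real.exp (2 * w z) * W a * (1 : Matrix (Fin n) (Fin n) ℝ) b c := by
    intro a b c
    have h1 : (fun x => G x b c) =ᶠ[𝓝 z]
        fun x => Real.exp (2 * w x) * (1 : Matrix (Fin n) (Fin n) ℝ) b c := by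
      filter_upwards [hG] with x hx
      simp [hx]
    rw [partialDeriv_congr h1, partialDeriv_of_hasFDerivAt
      (((hw.const_mul 2).exp).mul_const _)]
    simp [EuclideanSpace.inner_single_right]
    ring
  have hinv : (G z)⁻¹ = Real.exp (-(2 * w z)) • (1 : Matrix (Fin n) (Fin n) ℝ) := by
    apply Matrix.inv_eq_left_inv
    rw [hG.eq_of_nhds]
    simp [smul_smul, ← Real.exp_add]
  have he : Real.exp (-(2 * w z)) * Real.exp (2 * w z) = 1 := by simp [← Real.exp_add]
  simp only [christoffel, hd, hinv, Matrix.smul_apply, smul_eq_mul]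
  have : ∀ l, Real.exp (-(2 * w z)) * (1 : Matrix (Fin n) (Fin n) ℝ) k l *
      (2 * Real.exp (2 * w z) * W i * (1 : Matrix (Fin n) (Fin n) ℝ) j l
      + 2 * Real.exp (2 * w z) * W j * (1 : Matrix (Fin n) (Fin n) ℝ) i l
      - 2 * Real.exp (2 * w z) * W l * (1 : Matrix (Fin n) (Fin n) ℝ) i j)
      = (1 : Matrix (Fin n) (Fin n) ℝ) k l * (2 * (W i * (1 : Matrix (Fin n) (Fin n) ℝ) j l
        + W j * (1 : Matrix (Fin n) (Fin n) ℝ) i l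
        - W l * (1 : Matrix (Fin n) (Fin n) ℝ) i j)) := by
    intro l
    linear_combination (2 * (1 : Matrix (Fin n) (Fin n) ℝ) k l *
      (W i * (1 : Matrix (Fin n) (Fin n) ℝ) j l + W j * (1 : Matrix (Fin n) (Fin n) ℝ) i l
        - W l * (1 : Matrix (Fin n) (Fin n) ℝ) i j)) * he
  simp only [this]
  have h2 : ∀ c : Fin n → ℝ, ∑ l, (1 : Matrix (Fin n) (Fin n) ℝ) k l * c l = c k := by
    intro c
    simp [Matrix.one_apply]
  rw [h2]
  have hs : ∀ a b, (1 : Matrix (Fin n) (Fin n) ℝ) a b = (1 : Matrix (Fin n) (Fin n) ℝ) b a := by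
    intro a b; simp [Matrix.one_apply, eq_comm]
  rw [hs j k, hs i k]
  ring

/-- The curvature tensor of `e^{2w} δ`, in terms of the Euclidean gradient `W` of `w` and of its
derivative `L`, the Hessian of `w`. -/
lemma riemannTensor_conformal {G : 𝔼 → Matrix (Fin n) (Fin n) ℝ} {w : 𝔼 → ℝ} {W : 𝔼 → 𝔼}
    {L : 𝔼 →L[ℝ] 𝔼} {y : 𝔼}
    (hG : ∀ᶠ z in 𝓝 y, G z = Real.exp (2 * w z) • (1 : Matrix (Fin n) (Fin n) ℝ))
    (hw : ∀ᶠ z in 𝓝 y, HasFDerivAt w (innerSL ℝ (W z)) z)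
    (hW : HasFDerivAt W L y) (l i j k : Fin n) :
    let δ : Matrix (Fin n) (Fin n) ℝ := 1
    let H : Fin n → Fin n → ℝ := fun a b => (L (EuclideanSpace.single a 1)) b
    riemannTensor G l i j k y =
      δ l k * (H i j - H j i) + δ l j * (H i k - W y i * W y k)
        - δ j k * (H i l - W y i * W y l) - δ l i * (H j k - W y j * W y k)
        + δ i k * (H j l - W y j * W y l)
        - (∑ m, W y m ^ 2) * (δ l i * δ j k - δ l j * δ i k) := by
  intro δ H
  have hs : ∀ a b, δ a b = δ b a := by
    intro a b; simp [δ, Matrix.one_apply, eq_comm]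
  have hΓ : ∀ k i j, christoffel G k i j =ᶠ[𝓝 y]
      fun z => δ k j * W z i + δ k i * W z j - δ i j * W z k := by
    intro k i j
    filter_upwards [hG.eventually_nhds, hw] with z h1 h2
    exact christoffel_conformal h1 h2 k i j
  have hc : ∀ a : Fin n, HasFDerivAt (fun z => W z a) ((EuclideanSpace.proj a).comp L) y :=
    fun a => (EuclideanSpace.proj (𝕜 := ℝ) a).hasFDerivAt.comp y hW
  have hd : ∀ a k i j, partialDeriv a (christoffel G k i j) y
      = δ k j * H a i + δ k i * H a j - δ i j * H a k := by
    intro a k i j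
    rw [partialDeriv_congr (hΓ k i j)]
    refine (partialDeriv_of_hasFDerivAt
      ((((hc i).const_mul (δ k j)).add ((hc j).const_mul (δ k i))).sub
        ((hc k).const_mul (δ i j))) a).trans ?_
    simp [H]
  have hq : ∀ i j, ∑ m, christoffel G l i m y * christoffel G m j k y =
      W y i * (δ l k * W y j + δ l j * W y k - δ j k * W y l)
      + δ l i * (2 * W y j * W y k - δ j k * ∑ m, W y m ^ 2)
      - W y l * (δ i k * W y j + δ i j * W y k - δ j k * W y i) := by
    intro i j
    have h2 : ∀ (a : Fin n) (c : Fin n → ℝ), ∑ m, δ a m * c m = c a := by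
      intro a c
      simp [δ, Matrix.one_apply]
    have : ∀ m, christoffel G l i m y * christoffel G m j k y =
        δ l m * (W y i * (δ m k * W y j + δ m j * W y k - δ j k * W y m))
        + δ l i * (δ k m * (W y m * W y j) + δ j m * (W y m * W y k) - δ j k * W y m ^ 2)
        - W y l * (δ i m * (δ m k * W y j + δ m j * W y k - δ j k * W y m)) := by
      intro m
      rw [(hΓ l i m).eq_of_nhds, (hΓ m j k).eq_of_nhds, hs k m, hs j m]
      ring
    simp only [this, Finset.sum_add_distrib, Finset.sum_sub_distrib, ← Finset.mul_sum, h2]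
    ring
  simp only [riemannTensor, Finset.sum_sub_distrib, hd, hq]
  rw [hs j i]
  ring

lemma sum_single_eq (u : 𝔼) : ∑ i, u i • EuclideanSpace.single i (1 : ℝ) = u := by
  ext j
  simp [Finset.sum_apply, Pi.single_apply]

/-- The numerator of the sectional curvature of `e^{2w} δ`. -/
lemma sum_riemannTensor_conformal {G : 𝔼 → Matrix (Fin n) (Fin n) ℝ} {w : 𝔼 → ℝ} {W : 𝔼 → 𝔼}
    {L : 𝔼 →L[ℝ] 𝔼} {y : 𝔼}
    (hG : ∀ᶠ z in 𝓝 y, G z = Real.exp (2 * w z) • (1 : Matrix (Fin n) (Fin n) ℝ))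
    (hw : ∀ᶠ z in 𝓝 y, HasFDerivAt w (innerSL ℝ (W z)) z)
    (hW : HasFDerivAt W L y) (u v : 𝔼) :
    let h : 𝔼 → 𝔼 → ℝ := fun a b => inner ℝ (L a) b - inner ℝ (W y) a * inner ℝ (W y) b
    ∑ i, ∑ j, ∑ k, ∑ l, ∑ m, G y l m * riemannTensor G l i j k y * u i * v j * v k * u m
      = Real.exp (2 * w y) * (inner ℝ u v * (h u v + h v u) + inner ℝ u v *
        (inner ℝ (L u) v - inner ℝ (L v) u)
        - inner ℝ v v * h u u - inner ℝ u u * h v v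
        - inner ℝ (W y) (W y) * (inner ℝ u u * inner ℝ v v - inner ℝ u v ^ 2)) := by
  intro h
  set δ : Matrix (Fin n) (Fin n) ℝ := 1 with hδ
  set H : Fin n → Fin n → ℝ := fun a b => (L (EuclideanSpace.single a 1)) b with hH
  set N : ℝ := ∑ m, W y m ^ 2 with hN
  have hδs : ∀ (a : Fin n) (c : Fin n → ℝ), ∑ m, δ a m * c m = c a := by
    intro a c
    simp [δ, Matrix.one_apply]
  have hs : ∀ a b, δ a b = δ b a := by
    intro a b; simp [δ, Matrix.one_apply, eq_comm]
  have hin : ∀ a b : 𝔼, inner ℝ a b = ∑ i, a i * b i := by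
    intro a b
    simp [PiLp.inner_apply, mul_comm]
  have hL : ∀ a b : 𝔼, inner ℝ (L a) b = ∑ i, ∑ j, H i j * a i * b j := by
    intro a b
    have : L a = ∑ i, a i • L (EuclideanSpace.single i 1) := by
      conv_lhs => rw [← sum_single_eq a]
      simp
    rw [this, sum_inner]
    refine Finset.sum_congr rfl fun i _ => ?_
    rw [inner_smul_left, hin, Finset.mul_sum]
    refine Finset.sum_congr rfl fun j _ => ?_
    simp [H]; ring
  have key : ∀ i j k l, ∑ m, G y l m * riemannTensor G l i j k y * u i * v j * v k * u m
      = Real.exp (2 * w y) * (riemannTensor G l i j k y * u i * v j * v k * u l) := by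
    intro i j k l
    have : ∀ m, G y l m * riemannTensor G l i j k y * u i * v j * v k * u m
        = δ l m * (Real.exp (2 * w y) * (riemannTensor G l i j k y * u i * v j * v k * u m)) := by
      intro m
      rw [hG.self_of_nhds]
      simp only [Matrix.smul_apply, smul_eq_mul, δ]
      ring
    simp only [this, hδs]
  simp only [key, ← Finset.mul_sum]
  congr 1
  -- each Kronecker symbol is contracted against the sum over `l` or `k` that carries it
  have hl : ∀ i j k, ∑ l, riemannTensor G l i j k y * u i * v j * v k * u l
      = u k * v k * (u i * v j * (H i j - H j i)) + u j * v j * (u i * v k * (H i k - W y i * W y k))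
        - δ j k * v k * (v j * ∑ l, (H i l - W y i * W y l) * u i * u l)
        - u i * u i * ((H j k - W y j * W y k) * v j * v k)
        + δ i k * v k * (u i * ∑ l, (H j l - W y j * W y l) * v j * u l)
        - N * (u i * u i * (δ j k * v k * v j) - u j * v j * (δ i k * v k * u i)) := by
    intro i j k
    have : ∀ l, riemannTensor G l i j k y * u i * v j * v k * u l
        = δ k l * (u l * v k * (u i * v j * (H i j - H j i)))
        + δ j l * (u l * v j * (u i * v k * (H i k - W y i * W y k)))
        - δ j k * v k * (v j * ((H i l - W y i * W y l) * u i * u l))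
        - δ i l * (u l * u i * ((H j k - W y j * W y k) * v j * v k))
        + δ i k * v k * (u i * ((H j l - W y j * W y l) * v j * u l))
        - N * (δ i l * (u l * u i * (δ j k * v k * v j))
          - δ j l * (u l * v j * (δ i k * v k * u i))) := by
      intro l
      rw [riemannTensor_conformal hG hw hW]
      simp only [← hδ, ← hN]
      rw [hs l k, hs l j, hs l i]
      ring
    simp only [this, Finset.sum_add_distrib, Finset.sum_sub_distrib, ← Finset.mul_sum, hδs]
  have hk : ∀ i j, ∑ k, ∑ l, riemannTensor G l i j k y * u i * v j * v k * u l
      = inner ℝ u v * (u i * v j * (H i j - H j i))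
        + u j * v j * (∑ k, (H i k - W y i * W y k) * u i * v k)
        - v j * v j * (∑ l, (H i l - W y i * W y l) * u i * u l)
        - u i * u i * (∑ k, (H j k - W y j * W y k) * v j * v k)
        + v i * u i * (∑ l, (H j l - W y j * W y l) * v j * u l)
        - N * (u i * u i * (v j * v j) - u j * v j * (v i * u i)) := by
    intro i j
    have : ∀ k, ∑ l, riemannTensor G l i j k y * u i * v j * v k * u l
        = u k * v k * (u i * v j * (H i j - H j i))
          + u j * v j * ((H i k - W y i * W y k) * u i * v k)
        - δ j k * (v k * (v j * ∑ l, (H i l - W y i * W y l) * u i * u l))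
        - u i * u i * ((H j k - W y j * W y k) * v j * v k)
        + δ i k * (v k * (u i * ∑ l, (H j l - W y j * W y l) * v j * u l))
        - N * (u i * u i * (δ j k * (v k * v j)) - u j * v j * (δ i k * (v k * u i))) := by
      intro k
      rw [hl]; ring
    simp only [this, Finset.sum_add_distrib, Finset.sum_sub_distrib, ← Finset.mul_sum,
      ← Finset.sum_mul, hδs, hin]
    ring
  have hh : ∀ a b : 𝔼, h a b = ∑ i, ∑ j, (H i j - W y i * W y j) * a i * b j := by
    intro a b
    simp only [h, hL, hin, Finset.sum_mul_sum, ← Finset.sum_sub_distrib]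
    refine Finset.sum_congr rfl fun i _ => Finset.sum_congr rfl fun j _ => ?_
    ring
  have hNi : N = inner ℝ (W y) (W y) := by
    rw [hin, hN]; simp [pow_two]
  have huv : ∑ i, v i * u i = inner ℝ u v := by rw [hin]; simp [mul_comm]
  have hHuv : ∑ i, ∑ j, u i * v j * (H i j - H j i) = inner ℝ (L u) v - inner ℝ (L v) u := by
    rw [hL, hL]
    rw [Finset.sum_comm (f := fun i j => H i j * v i * u j)]
    simp only [← Finset.sum_sub_distrib]
    refine Finset.sum_congr rfl fun i _ => Finset.sum_congr rfl fun j _ => ?_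
    ring
  simp only [hk, Finset.sum_add_distrib, Finset.sum_sub_distrib, ← Finset.mul_sum,
    ← Finset.sum_mul]
  rw [hHuv, huv, ← hin u v, ← hin v v, ← hin u u, ← hNi, hh u v, hh v u, hh u u, hh v v]
  ring

lemma coordInner_conformal {G : 𝔼 → Matrix (Fin n) (Fin n) ℝ} {c : ℝ} {y : 𝔼}
    (hG : G y = c • (1 : Matrix (Fin n) (Fin n) ℝ)) (u v : 𝔼) :
    coordInner G y u v = c * inner ℝ u v := by
  simp [coordInner, hG, Matrix.one_apply, PiLp.inner_apply, Finset.mul_sum]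
  refine Finset.sum_congr rfl fun i _ => ?_
  ring

/-- The sectional curvature of `e^{2w} δ` when the Hessian of `w` is symmetric. -/
lemma coordSectionalCurvature_conformal {G : 𝔼 → Matrix (Fin n) (Fin n) ℝ} {w : 𝔼 → ℝ} {W : 𝔼 → 𝔼}
    {L : 𝔼 →L[ℝ] 𝔼} {y : 𝔼}
    (hG : ∀ᶠ z in 𝓝 y, G z = Real.exp (2 * w z) • (1 : Matrix (Fin n) (Fin n) ℝ))
    (hw : ∀ᶠ z in 𝓝 y, HasFDerivAt w (innerSL ℝ (W z)) z)
    (hW : HasFDerivAt W L y) (u v : 𝔼) (hL : inner ℝ (L u) v = inner ℝ (L v) u) :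
    let h : 𝔼 → 𝔼 → ℝ := fun a b => inner ℝ (L a) b - inner ℝ (W y) a * inner ℝ (W y) b
    let D : ℝ := inner ℝ u u * inner ℝ v v - inner ℝ u v ^ 2
    coordSectionalCurvature G y u v
      = Real.exp (-(2 * w y)) * ((2 * inner ℝ u v * h u v
        - inner ℝ v v * h u u - inner ℝ u u * h v v - inner ℝ (W y) (W y) * D) / D) := by
  intro h D
  simp only [coordSectionalCurvature]
  rw [sum_riemannTensor_conformal hG hw hW]
  simp only [coordInner_conformal hG.self_of_nhds]
  have e1 : Real.exp (2 * w y) * inner ℝ u u * (Real.exp (2 * w y) * inner ℝ v v)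
      - (Real.exp (2 * w y) * inner ℝ u v) ^ 2 = Real.exp (2 * w y) * (Real.exp (2 * w y) * D) := by
    simp only [D]; ring
  rw [e1, mul_div_mul_left _ _ (Real.exp_pos _).ne', mul_comm (Real.exp (2 * w y)) D, ← div_div,
    Real.exp_neg, div_eq_inv_mul _ (Real.exp (2 * w y))]
  congr 2
  simp only [h, D, hL]
  ring

end Curvature

/-! ### Conformal factors built from two isotropic quadratic polynomials -/

section Gram

variable {V : Type*} [NormedAddCommGroup V] [InnerProductSpace ℝ V]

lemma gram_pos_of_linearIndependent {u v : V} (h : LinearIndependent ℝ ![u, v]) :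
    0 < inner ℝ u u * inner ℝ v v - inner ℝ u v ^ 2 := by
  have hv : v ≠ 0 := by simpa using h.ne_zero 1
  have hvv : 0 < inner ℝ v v := real_inner_self_pos.2 hv
  have hne : inner ℝ v v • u - inner ℝ u v • v ≠ 0 := by
    intro h0
    have := (LinearIndependent.pair_iff.1 h) (inner ℝ v v) (-inner ℝ u v)
      (by rw [neg_smul, ← sub_eq_add_neg, h0])
    exact hvv.ne' this.1
  have h1 := real_inner_self_pos.2 hne
  have h2 : inner ℝ (inner ℝ v v • u - inner ℝ u v • v) (inner ℝ v v • u - inner ℝ u v • v)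
      = inner ℝ v v * (inner ℝ u u * inner ℝ v v - inner ℝ u v ^ 2) := by
    simp only [inner_sub_left, inner_sub_right, real_inner_smul_left, real_inner_smul_right,
      real_inner_comm u v]
    ring
  rw [h2] at h1
  exact (mul_pos_iff_of_pos_left hvv).1 h1

/-- Up to the factor `D`, the area squared of the parallelogram on `u, v`, the middle quantity is
the squared norm of the orthogonal projection of `t` to the plane of `u, v`. -/
lemma projection_bounds (u v t : V) (hD : 0 < inner ℝ u u * inner ℝ v v - inner ℝ u v ^ 2) :
    0 ≤ inner ℝ v v * inner ℝ t u ^ 2 + inner ℝ u u * inner ℝ t v ^ 2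
        - 2 * inner ℝ u v * (inner ℝ t u * inner ℝ t v) ∧
    inner ℝ v v * inner ℝ t u ^ 2 + inner ℝ u u * inner ℝ t v ^ 2
        - 2 * inner ℝ u v * (inner ℝ t u * inner ℝ t v)
      ≤ inner ℝ t t * (inner ℝ u u * inner ℝ v v - inner ℝ u v ^ 2) := by
  set D : ℝ := inner ℝ u u * inner ℝ v v - inner ℝ u v ^ 2 with hDdef
  constructor
  · have h : 0 ≤ inner ℝ (inner ℝ t u • v - inner ℝ t v • u) (inner ℝ t u • v - inner ℝ t v • u) :=
      real_inner_self_nonneg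
    simp only [inner_sub_left, inner_sub_right, real_inner_smul_left, real_inner_smul_right,
      real_inner_comm u v] at h
    linarith
  · have h : 0 ≤ inner ℝ (D • t - (inner ℝ v v * inner ℝ t u - inner ℝ u v * inner ℝ t v) • u
        - (inner ℝ u u * inner ℝ t v - inner ℝ u v * inner ℝ t u) • v)
        (D • t - (inner ℝ v v * inner ℝ t u - inner ℝ u v * inner ℝ t v) • u
        - (inner ℝ u u * inner ℝ t v - inner ℝ u v * inner ℝ t u) • v) := real_inner_self_nonneg
    have h2 : inner ℝ (D • t - (inner ℝ v v * inner ℝ t u - inner ℝ u v * inner ℝ t v) • u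
        - (inner ℝ u u * inner ℝ t v - inner ℝ u v * inner ℝ t u) • v)
        (D • t - (inner ℝ v v * inner ℝ t u - inner ℝ u v * inner ℝ t v) • u
        - (inner ℝ u u * inner ℝ t v - inner ℝ u v * inner ℝ t u) • v)
        = D * (inner ℝ t t * D - (inner ℝ v v * inner ℝ t u ^ 2 + inner ℝ u u * inner ℝ t v ^ 2
        - 2 * inner ℝ u v * (inner ℝ t u * inner ℝ t v))) := by
      simp only [inner_sub_left, inner_sub_right, real_inner_smul_left, real_inner_smul_right,
        real_inner_comm u v, real_inner_comm t u, real_inner_comm t v]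
      rw [hDdef]
      ring
    rw [h2] at h
    linarith [nonneg_of_mul_nonneg_right h hD]

/-- Algebra behind the curvature bound. Here `a` and `b` stand for the logarithmic gradients of
two isotropic quadratic polynomials, `p` and `q` for the first two derivatives of the profile, and
`h` for the difference of the Hessian of the conformal exponent and of the square of its
gradient. -/
lemma curvature_numerator_lower_bound {u v a b : V} {kA kB p q : ℝ} {h : V → V → ℝ} (W : V)
    (hD : 0 < inner ℝ u u * inner ℝ v v - inner ℝ u v ^ 2)
    (ha : inner ℝ a a = 4 * kA) (hb : inner ℝ b b = 4 * kB)
    (hp0 : 0 ≤ p) (hp1 : p ≤ 1) (hW : W = -((1 - p) • a + p • b))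
    (hh : ∀ x y, h x y = -((1 - p) * (2 * kA * inner ℝ x y - inner ℝ a x * inner ℝ a y)
      + p * (2 * kB * inner ℝ x y - inner ℝ b x * inner ℝ b y)
      + q * (inner ℝ (b - a) x * inner ℝ (b - a) y)) - inner ℝ W x * inner ℝ W y) :
    -(|q| * inner ℝ (b - a) (b - a)) ≤
      (2 * inner ℝ u v * h u v - inner ℝ v v * h u u - inner ℝ u u * h v v
        - inner ℝ W W * (inner ℝ u u * inner ℝ v v - inner ℝ u v ^ 2)) /
      (inner ℝ u u * inner ℝ v v - inner ℝ u v ^ 2) := by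
  obtain ⟨hT0, hT1⟩ := projection_bounds u v (b - a) hD
  set T : ℝ := inner ℝ v v * inner ℝ (b - a) u ^ 2 + inner ℝ u u * inner ℝ (b - a) v ^ 2
        - 2 * inner ℝ u v * (inner ℝ (b - a) u * inner ℝ (b - a) v) with hT
  set D : ℝ := inner ℝ u u * inner ℝ v v - inner ℝ u v ^ 2 with hDdef
  have key : 2 * inner ℝ u v * h u v - inner ℝ v v * h u u - inner ℝ u u * h v v
      - inner ℝ W W * D = p * (1 - p) * (inner ℝ (b - a) (b - a) * D - T) + q * T := by
    have hWW : inner ℝ W W = 4 * ((1 - p) * kA + p * kB)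
        - p * (1 - p) * inner ℝ (b - a) (b - a) := by
      rw [hW]
      simp only [inner_neg_neg, inner_add_left, inner_add_right, real_inner_smul_left,
        real_inner_smul_right, inner_sub_left, inner_sub_right, real_inner_comm b a, ha, hb]
      ring
    rw [hWW, hh, hh, hh, hT, hDdef, hW]
    simp only [inner_neg_left, inner_add_left, real_inner_smul_left, inner_sub_left]
    ring
  rw [key, le_div_iff₀ hD]
  have h1 : 0 ≤ p * (1 - p) * (inner ℝ (b - a) (b - a) * D - T) :=
    mul_nonneg (mul_nonneg hp0 (by linarith)) (by linarith)
  have h2 : -(|q| * T) ≤ q * T := by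
    have := mul_le_mul_of_nonneg_right (neg_abs_le q) hT0
    linarith
  have h3 : |q| * T ≤ |q| * (inner ℝ (b - a) (b - a) * D) :=
    mul_le_mul_of_nonneg_left hT1 (abs_nonneg q)
  linarith

end Gram

section Quadratic

variable {n : ℕ}

local notation "𝔼" => EuclideanSpace ℝ (Fin n)

/-- The quadratic polynomial `α + ⟨β, y⟩ + γ |y|²`, whose Hessian is a multiple of the scalar
product. -/
def isotropicQuadratic (α : ℝ) (β : 𝔼) (γ : ℝ) (y : 𝔼) : ℝ := α + inner ℝ β y + γ * ‖y‖ ^ 2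

lemma hasFDerivAt_isotropicQuadratic (α : ℝ) (β : 𝔼) (γ : ℝ) (y : 𝔼) :
    HasFDerivAt (isotropicQuadratic α β γ) (innerSL ℝ (β + (2 * γ) • y)) y := by
  have h1 : HasFDerivAt (fun y : 𝔼 => ‖y‖ ^ 2) (2 • innerSL ℝ y) y :=
    (hasStrictFDerivAt_norm_sq y).hasFDerivAt
  have h2 : HasFDerivAt (fun y : 𝔼 => inner ℝ β y) (innerSL ℝ β) y := (innerSL ℝ β).hasFDerivAt
  have h := (h2.const_add α).add (h1.const_mul γ)
  refine h.congr_fderiv ?_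
  ext x
  simp
  ring

/-- The logarithmic gradient of `isotropicQuadratic α β γ`. -/
def logGradient (α : ℝ) (β : 𝔼) (γ : ℝ) (y : 𝔼) : 𝔼 :=
  (isotropicQuadratic α β γ y)⁻¹ • (β + (2 * γ) • y)

lemma hasFDerivAt_log_isotropicQuadratic {α : ℝ} {β : 𝔼} {γ : ℝ} {y : 𝔼}
    (hy : 0 < isotropicQuadratic α β γ y) :
    HasFDerivAt (fun z => Real.log (isotropicQuadratic α β γ z))
      (innerSL ℝ (logGradient α β γ y)) y := by
  refine ((hasFDerivAt_isotropicQuadratic α β γ y).log hy.ne').congr_fderiv ?_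
  ext x
  simp [logGradient]

lemma exists_hasFDerivAt_logGradient {α : ℝ} {β : 𝔼} {γ : ℝ} {y : 𝔼}
    (hy : 0 < isotropicQuadratic α β γ y) :
    ∃ L : 𝔼 →L[ℝ] 𝔼, HasFDerivAt (logGradient α β γ) L y ∧
      ∀ x, L x = (2 * (γ / isotropicQuadratic α β γ y)) • x
        - inner ℝ (logGradient α β γ y) x • logGradient α β γ y := by
  have h1 : HasFDerivAt (fun z : 𝔼 => β + (2 * γ) • z) ((2 * γ) • ContinuousLinearMap.id ℝ 𝔼) y :=
    ((hasFDerivAt_id y).const_smul (2 * γ)).const_add β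
  have h2 := (hasDerivAt_inv hy.ne').comp_hasFDerivAt y (hasFDerivAt_isotropicQuadratic α β γ y)
  refine ⟨_, h2.smul h1, fun x => ?_⟩
  simp only [Function.comp_apply, logGradient, add_apply,
    smul_apply, ContinuousLinearMap.smulRight_apply, innerSL_apply_apply,
    ContinuousLinearMap.id_apply, real_inner_smul_left, smul_eq_mul, smul_smul]
  module

/-- The null condition `|β|² = 4αγ` expresses that the metric `A⁻² |dy|²` is flat. -/
lemma inner_logGradient_self {α : ℝ} {β : 𝔼} {γ : ℝ} {y : 𝔼}
    (hy : 0 < isotropicQuadratic α β γ y) (hnull : inner ℝ β β = 4 * α * γ) :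
    inner ℝ (logGradient α β γ y) (logGradient α β γ y)
      = 4 * (γ / isotropicQuadratic α β γ y) := by
  have : inner ℝ (β + (2 * γ) • y) (β + (2 * γ) • y) = 4 * γ * isotropicQuadratic α β γ y := by
    simp only [inner_add_left, inner_add_right, real_inner_smul_left, real_inner_smul_right,
      hnull, isotropicQuadratic, real_inner_comm β y, real_inner_self_eq_norm_sq y]
    ring
  rw [logGradient, real_inner_smul_left, real_inner_smul_right, this]
  field_simp

lemma inner_logGradient_sub_self {α β' γ' γ : ℝ} {β δ : 𝔼} {y : 𝔼}
    (hA : 0 < isotropicQuadratic α β γ y) (hB : 0 < isotropicQuadratic β' δ γ' y)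
    (hAn : inner ℝ β β = 4 * α * γ) (hBn : inner ℝ δ δ = 4 * β' * γ') :
    inner ℝ (logGradient β' δ γ' y - logGradient α β γ y)
      (logGradient β' δ γ' y - logGradient α β γ y)
      = 2 * (2 * α * γ' + 2 * β' * γ - inner ℝ β δ)
        / (isotropicQuadratic α β γ y * isotropicQuadratic β' δ γ' y) := by
  have hab : inner ℝ (β + (2 * γ) • y) (δ + (2 * γ') • y)
      = 2 * γ * isotropicQuadratic β' δ γ' y + 2 * γ' * isotropicQuadratic α β γ y
        + (inner ℝ β δ - 2 * α * γ' - 2 * β' * γ) := by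
    simp only [inner_add_left, inner_add_right, real_inner_smul_left, real_inner_smul_right,
      isotropicQuadratic, real_inner_comm δ y, real_inner_self_eq_norm_sq y]
    ring
  have hc : inner ℝ (logGradient α β γ y) (logGradient β' δ γ' y)
      = (isotropicQuadratic α β γ y)⁻¹ * ((isotropicQuadratic β' δ γ' y)⁻¹ *
        inner ℝ (β + (2 * γ) • y) (δ + (2 * γ') • y)) := by
    rw [logGradient, logGradient, real_inner_smul_left, real_inner_smul_right]
  rw [inner_sub_left, inner_sub_right, inner_sub_right, inner_logGradient_self hA hAn,
    inner_logGradient_self hB hBn, real_inner_comm (logGradient α β γ y) (logGradient β' δ γ' y),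
    hc, hab]
  field_simp
  ring

/-- Lower bound for the sectional curvature of `e^{2w} δ` with
`w = - log A - φ (log B - log A)`, where `A` and `B` are null isotropic quadratic polynomials. -/
lemma le_coordSectionalCurvature_of_profile {G : 𝔼 → Matrix (Fin n) (Fin n) ℝ} {w : 𝔼 → ℝ}
    {φ φ₁ φ₂ : ℝ → ℝ} (hφ : ∀ t, HasDerivAt φ (φ₁ t) t) (hφ₁ : ∀ t, HasDerivAt φ₁ (φ₂ t) t)
    (hφ0 : ∀ t, 0 ≤ φ₁ t) (hφ1 : ∀ t, φ₁ t ≤ 1)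
    {α γ α' γ' : ℝ} {β β' y : 𝔼}
    (hA : 0 < isotropicQuadratic α β γ y) (hB : 0 < isotropicQuadratic α' β' γ' y)
    (hAn : inner ℝ β β = 4 * α * γ) (hBn : inner ℝ β' β' = 4 * α' * γ')
    (hG : ∀ᶠ z in 𝓝 y, G z = Real.exp (2 * w z) • (1 : Matrix (Fin n) (Fin n) ℝ))
    (hw : ∀ᶠ z in 𝓝 y, w z = -Real.log (isotropicQuadratic α β γ z)
      - φ (Real.log (isotropicQuadratic α' β' γ' z) - Real.log (isotropicQuadratic α β γ z)))
    {u v : 𝔼} (huv : LinearIndependent ℝ ![u, v]) :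
    -(Real.exp (-(2 * w y)) *
      (|φ₂ (Real.log (isotropicQuadratic α' β' γ' y) - Real.log (isotropicQuadratic α β γ y))| *
        (2 * (2 * α * γ' + 2 * α' * γ - inner ℝ β β')
        / (isotropicQuadratic α β γ y * isotropicQuadratic α' β' γ' y))))
      ≤ coordSectionalCurvature G y u v := by
  set A := isotropicQuadratic α β γ with hAdef
  set B := isotropicQuadratic α' β' γ' with hBdef
  set a := logGradient α β γ with hadef
  set b := logGradient α' β' γ' with hbdef
  set τ : 𝔼 → ℝ := fun z => Real.log (B z) - Real.log (A z) with hτ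
  have hcA : ContinuousAt A y := (hasFDerivAt_isotropicQuadratic α β γ y).continuousAt
  have hcB : ContinuousAt B y := (hasFDerivAt_isotropicQuadratic α' β' γ' y).continuousAt
  have hτd : ∀ z, 0 < A z → 0 < B z → HasFDerivAt τ (innerSL ℝ (b z - a z)) z := by
    intro z hz hz'
    refine ((hasFDerivAt_log_isotropicQuadratic hz').sub
      (hasFDerivAt_log_isotropicQuadratic hz)).congr_fderiv ?_
    simp [hadef, hbdef]
  -- The gradient of `w` is a convex combination of the logarithmic gradients.
  set W : 𝔼 → 𝔼 := fun z => -((1 - φ₁ (τ z)) • a z + φ₁ (τ z) • b z) with hWdef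
  have hpos : ∀ᶠ z in 𝓝 y, 0 < A z ∧ 0 < B z :=
    (hcA.eventually_const_lt hA).and (hcB.eventually_const_lt hB)
  have hwd : ∀ᶠ z in 𝓝 y, HasFDerivAt w (innerSL ℝ (W z)) z := by
    filter_upwards [hpos, hw.eventually_nhds] with z hz hwz
    have h1 := (hasFDerivAt_log_isotropicQuadratic hz.1).neg.sub
      ((hφ (τ z)).comp_hasFDerivAt z (hτd z hz.1 hz.2))
    refine (h1.congr_of_eventuallyEq hwz).congr_fderiv ?_
    ext x
    simp [W, hadef]
    ring
  obtain ⟨La, hLa, hLa'⟩ := exists_hasFDerivAt_logGradient hA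
  obtain ⟨Lb, hLb, hLb'⟩ := exists_hasFDerivAt_logGradient hB
  have hp := (hφ₁ (τ y)).comp_hasFDerivAt y (hτd y hA hB)
  have hWd := (((hp.const_sub 1).smul hLa).add (hp.smul hLb)).neg
  set L : 𝔼 →L[ℝ] 𝔼 := _ with hL
  change HasFDerivAt W L y at hWd
  set kA := γ / A y
  set kB := γ' / B y
  set p := φ₁ (τ y)
  set q := φ₂ (τ y)
  have hLin : ∀ x z, inner ℝ (L x) z =
      -((1 - p) * (2 * kA * inner ℝ x z - inner ℝ (a y) x * inner ℝ (a y) z)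
      + p * (2 * kB * inner ℝ x z - inner ℝ (b y) x * inner ℝ (b y) z)
      + q * (inner ℝ (b y - a y) x * inner ℝ (b y - a y) z)) := by
    intro x z
    have : L x = -((1 - p) • ((2 * kA) • x - inner ℝ (a y) x • a y)
      + p • ((2 * kB) • x - inner ℝ (b y) x • b y)
      + (q * inner ℝ (b y - a y) x) • (b y - a y)) := by
      rw [hL]
      simp only [Function.comp_apply, neg_apply, add_apply,
        smul_apply, ContinuousLinearMap.smulRight_apply, innerSL_apply_apply,
        smul_eq_mul, hLa', hLb', p, q, kA, kB, hadef, hbdef]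
      module
    rw [this]
    simp only [inner_neg_left, inner_add_left, real_inner_smul_left, inner_sub_left]
    ring
  have hLs : inner ℝ (L u) v = inner ℝ (L v) u := by
    rw [hLin, hLin, real_inner_comm]
    ring
  rw [coordSectionalCurvature_conformal hG hwd hWd u v hLs, ← mul_neg]
  refine mul_le_mul_of_nonneg_left ?_ (Real.exp_pos _).le
  rw [← inner_logGradient_sub_self hA hB hAn hBn]
  refine curvature_numerator_lower_bound (kA := kA) (kB := kB) (p := p) (q := q)
    (h := fun x z => inner ℝ (L x) z - inner ℝ (W y) x * inner ℝ (W y) z) (W y)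
    (gram_pos_of_linearIndependent huv)
    (inner_logGradient_self hA hAn) (inner_logGradient_self hB hBn) (hφ0 _) (hφ1 _) rfl ?_
  intro x z
  simp only [hLin]
  rfl

end Quadratic

/-! ### Stereographic charts of domains of the sphere -/

section Chart

variable {n : ℕ}

local notation "𝔼" => EuclideanSpace ℝ (Fin n)
local notation "𝔽" => EuclideanSpace ℝ (Fin (n + 1))

/-- The linear isometry of `ℝⁿ` onto the hyperplane `v^⊥` that underlies Mathlib's stereographic
chart with pole `v`. -/
def poleIsometry (v : UnitSphere n) : 𝔼 →ₗᵢ[ℝ] 𝔽 :=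
  haveI := Fact.mk (@finrank_euclideanSpace_fin ℝ _ (n + 1))
  (ℝ ∙ (v : 𝔽))ᗮ.subtypeₗᵢ.comp
    (OrthonormalBasis.fromOrthogonalSpanSingleton n
      (ne_zero_of_mem_unit_sphere v)).repr.symm.toLinearIsometry

lemma inner_poleIsometry (v : UnitSphere n) (y : 𝔼) :
    inner ℝ (v : 𝔽) (poleIsometry v y) = 0 :=
  Submodule.mem_orthogonal_singleton_iff_inner_right.1 (Subtype.property _)

lemma inner_self_unitSphere (v : UnitSphere n) : inner ℝ (v : 𝔽) (v : 𝔽) = 1 := by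
  rw [real_inner_self_eq_norm_sq, norm_eq_of_mem_sphere]; norm_num

lemma exists_poleIsometry_eq (v : UnitSphere n) (a : 𝔽) :
    ∃ z : 𝔼, poleIsometry v z = a - inner ℝ (v : 𝔽) a • (v : 𝔽) := by
  have := Fact.mk (@finrank_euclideanSpace_fin ℝ _ (n + 1))
  have h : a - inner ℝ (v : 𝔽) a • (v : 𝔽) ∈ (ℝ ∙ (v : 𝔽))ᗮ := by
    rw [Submodule.mem_orthogonal_singleton_iff_inner_right, inner_sub_right,
      real_inner_smul_right, inner_self_unitSphere]
    ring
  refine ⟨(OrthonormalBasis.fromOrthogonalSpanSingleton n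
      (ne_zero_of_mem_unit_sphere v)).repr ⟨_, h⟩, ?_⟩
  simp [poleIsometry]

/-- The coordinates of the orthogonal projection of `a` to `v^⊥`. -/
def poleCoord (v : UnitSphere n) (a : 𝔽) : 𝔼 := (exists_poleIsometry_eq v a).choose

lemma poleIsometry_poleCoord (v : UnitSphere n) (a : 𝔽) :
    poleIsometry v (poleCoord v a) = a - inner ℝ (v : 𝔽) a • (v : 𝔽) :=
  (exists_poleIsometry_eq v a).choose_spec

lemma inner_poleIsometry_left (v : UnitSphere n) (y : 𝔼) (a : 𝔽) :
    inner ℝ (poleIsometry v y) a = inner ℝ y (poleCoord v a) := by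
  rw [← (poleIsometry v).inner_map_map y, poleIsometry_poleCoord, inner_sub_right,
    real_inner_smul_right, real_inner_comm, real_inner_comm (v : 𝔽), inner_poleIsometry]
  ring

lemma inner_poleCoord (v : UnitSphere n) (a b : 𝔽) :
    inner ℝ (poleCoord v a) (poleCoord v b)
      = inner ℝ a b - inner ℝ (v : 𝔽) a * inner ℝ (v : 𝔽) b := by
  rw [← (poleIsometry v).inner_map_map, poleIsometry_poleCoord, poleIsometry_poleCoord]
  simp only [inner_sub_left, inner_sub_right, real_inner_smul_left, real_inner_smul_right,
    inner_self_unitSphere, real_inner_comm (v : 𝔽) a]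
  ring

/-- The inverse of the stereographic projection with pole `v`, with values in `ℝⁿ⁺¹`. -/
def invStereo (v : UnitSphere n) (y : 𝔼) : 𝔽 :=
  (‖y‖ ^ 2 + 4)⁻¹ • ((4 : ℝ) • poleIsometry v y + (‖y‖ ^ 2 - 4) • (v : 𝔽))

lemma invStereo_eq (v : UnitSphere n) (y : 𝔼) :
    haveI := Fact.mk (@finrank_euclideanSpace_fin ℝ _ (n + 1))
    ((stereographic' n v).symm y : 𝔽) = invStereo v y := by
  have := Fact.mk (@finrank_euclideanSpace_fin ℝ _ (n + 1))
  have h : ∀ z : (ℝ ∙ (v : 𝔽))ᗮ, ‖(z : 𝔽)‖ = ‖z‖ := fun _ => rfl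
  rw [stereographic'_symm_apply, invStereo, smul_add]
  simp only [h, LinearIsometryEquiv.norm_map]
  rfl

lemma inner_invStereo (v : UnitSphere n) (y : 𝔼) (a : 𝔽) :
    inner ℝ (invStereo v y) a = (‖y‖ ^ 2 + 4)⁻¹ *
      (4 * inner ℝ y (poleCoord v a) + (‖y‖ ^ 2 - 4) * inner ℝ (v : 𝔽) a) := by
  rw [invStereo, real_inner_smul_left, inner_add_left, real_inner_smul_left, real_inner_smul_left,
    inner_poleIsometry_left]

/-- In a stereographic chart, the affine function `1 - ⟨·, a⟩` is an isotropic quadratic polynomial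
up to the conformal factor of the chart. -/
lemma one_sub_inner_invStereo (v : UnitSphere n) (y : 𝔼) (a : 𝔽) :
    (1 - inner ℝ (invStereo v y) a) * ((‖y‖ ^ 2 + 4) / 4)
      = isotropicQuadratic (1 + inner ℝ (v : 𝔽) a) (-poleCoord v a)
          ((1 - inner ℝ (v : 𝔽) a) / 4) y := by
  have h : ‖y‖ ^ 2 + 4 ≠ 0 := by positivity
  rw [inner_invStereo, isotropicQuadratic, inner_neg_left, real_inner_comm]
  field_simp
  ring

/-- The derivative of the inverse stereographic projection. -/
def invStereoDeriv (v : UnitSphere n) (y u : 𝔼) : 𝔽 :=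
  (‖y‖ ^ 2 + 4)⁻¹ • ((4 : ℝ) • poleIsometry v u + (2 * inner ℝ y u) • (v : 𝔽)
    - (2 * inner ℝ y u) • invStereo v y)

lemma contDiff_invStereo (v : UnitSphere n) : ContDiff ℝ ∞ (invStereo v) := by
  have h₀ : ContDiff ℝ ∞ fun y : 𝔼 => ‖y‖ ^ 2 := contDiff_norm_sq ℝ
  have h₁ : ContDiff ℝ ∞ fun y : 𝔼 => poleIsometry v y :=
    (poleIsometry v).toContinuousLinearMap.contDiff
  have h₂ : ContDiff ℝ ∞ fun y : 𝔼 => (‖y‖ ^ 2 + 4)⁻¹ :=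
    (h₀.add contDiff_const).inv fun x => by positivity
  unfold invStereo
  exact h₂.fun_smul ((contDiff_const.fun_smul h₁).add
    ((h₀.sub contDiff_const).fun_smul contDiff_const))

lemma fderiv_invStereo (v : UnitSphere n) (y u : 𝔼) :
    fderiv ℝ (invStereo v) y u = invStereoDeriv v y u := by
  have h0 : HasFDerivAt (fun y : 𝔼 => ‖y‖ ^ 2) (2 • innerSL ℝ y) y :=
    (hasStrictFDerivAt_norm_sq y).hasFDerivAt
  have hne : ‖y‖ ^ 2 + 4 ≠ 0 := by positivity
  have h1 := (hasDerivAt_inv hne).comp_hasFDerivAt y (h0.add_const 4)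
  have h2 := (((poleIsometry v).toContinuousLinearMap.hasFDerivAt (x := y)).const_smul
    (4 : ℝ)).add ((h0.sub_const 4).smul_const (v : 𝔽))
  have h3 : HasFDerivAt (invStereo v) _ y := h1.smul h2
  rw [h3.fderiv, invStereoDeriv, invStereo]
  simp [← inv_pow]
  module

lemma inner_invStereo_pole (v : UnitSphere n) (y : 𝔼) :
    inner ℝ (invStereo v y) (v : 𝔽) = (‖y‖ ^ 2 + 4)⁻¹ * (‖y‖ ^ 2 - 4) := by
  rw [invStereo, real_inner_smul_left, inner_add_left, real_inner_smul_left, real_inner_smul_left,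
    real_inner_comm, inner_poleIsometry, inner_self_unitSphere]
  ring

lemma inner_invStereo_poleIsometry (v : UnitSphere n) (y u : 𝔼) :
    inner ℝ (invStereo v y) (poleIsometry v u) = (‖y‖ ^ 2 + 4)⁻¹ * (4 * inner ℝ y u) := by
  rw [invStereo, real_inner_smul_left, inner_add_left, real_inner_smul_left, real_inner_smul_left,
    inner_poleIsometry, (poleIsometry v).inner_map_map]
  ring

/-- The stereographic projection is conformal. -/
lemma inner_invStereoDeriv (v : UnitSphere n) (y u w : 𝔼) :
    inner ℝ (invStereoDeriv v y u) (invStereoDeriv v y w)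
      = (4 / (‖y‖ ^ 2 + 4)) ^ 2 * inner ℝ u w := by
  have hne : ‖y‖ ^ 2 + 4 ≠ 0 := by positivity
  have hself : inner ℝ (invStereo v y) (invStereo v y) = 1 := by
    rw [← invStereo_eq]; exact inner_self_unitSphere _
  have h1 : inner ℝ (poleIsometry v u) (invStereo v y) = (‖y‖ ^ 2 + 4)⁻¹ * (4 * inner ℝ y u) := by
    rw [real_inner_comm, inner_invStereo_poleIsometry]
  have h2 : inner ℝ (v : 𝔽) (invStereo v y) = (‖y‖ ^ 2 + 4)⁻¹ * (‖y‖ ^ 2 - 4) := by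
    rw [real_inner_comm, inner_invStereo_pole]
  have h3 : inner ℝ (poleIsometry v u) (v : 𝔽) = 0 := by
    rw [real_inner_comm, inner_poleIsometry]
  simp only [invStereoDeriv, real_inner_smul_left, real_inner_smul_right, inner_add_left,
    inner_sub_left, inner_add_right, inner_sub_right, hself, h1, h2, h3, inner_poleIsometry,
    inner_invStereo_pole, inner_invStereo_poleIsometry, inner_self_unitSphere,
    (poleIsometry v).inner_map_map]
  field_simp
  ring

lemma mdifferentiableAt_extChartAt_symm {M : Type*} [TopologicalSpace M]
    [ChartedSpace (EuclideanSpace ℝ (Fin n)) M] [IsManifold (𝓡 n) ∞ M] (p : M) {y : 𝔼}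
    (hy : y ∈ (extChartAt (𝓡 n) p).target) :
    MDifferentiableAt 𝓘(ℝ, 𝔼) (𝓡 n) (extChartAt (𝓡 n) p).symm y :=
  have : IsManifold (𝓡 n) 1 M := .of_le (n := ∞) (by simp)
  ((contMDiffOn_extChartAt_symm (n := 1) p).contMDiffAt
    ((isOpen_extChartAt_target p).mem_nhds hy)).mdifferentiableAt one_ne_zero

variable {Ω : TopologicalSpace.Opens (UnitSphere n)}

/-- The inclusion of a domain of the sphere into `ℝⁿ⁺¹`. -/
abbrev ambient (z : Ω) : 𝔽 := ((z : UnitSphere n) : 𝔽)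

lemma contMDiff_ambient : ContMDiff (𝓡 n) 𝓘(ℝ, 𝔽) ∞ (ambient (Ω := Ω)) := by
  have := Fact.mk (@finrank_euclideanSpace_fin ℝ _ (n + 1))
  exact (contMDiff_coe_sphere (n := n) (E := 𝔽)).comp (contMDiff_subtype_val (U := Ω))

lemma ambient_extChartAt_symm (p : Ω) {y : 𝔼} (hy : y ∈ (extChartAt (𝓡 n) p).target) :
    ambient ((extChartAt (𝓡 n) p).symm y) = invStereo (-(p : UnitSphere n)) y := by
  have := Fact.mk (@finrank_euclideanSpace_fin ℝ _ (n + 1))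
  rw [← invStereo_eq]
  have hy' : y ∈ ((chartAt 𝔼 (p : UnitSphere n)).subtypeRestr ⟨p⟩).target := by
    simpa [extChartAt, TopologicalSpace.Opens.chartAt_eq] using hy
  have := (chartAt 𝔼 (p : UnitSphere n)).subtypeRestr_symm_apply ⟨p⟩ hy'
  have h2 : (((extChartAt (𝓡 n) p).symm y : Ω) : UnitSphere n)
      = (stereographic' n (-(p : UnitSphere n))).symm y := by
    simpa [extChartAt, TopologicalSpace.Opens.chartAt_eq] using! this
  exact congrArg Subtype.val h2

lemma extChartAt_source_eq (p : Ω) :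
    (extChartAt (𝓡 n) p).source = {z : Ω | (z : UnitSphere n) ≠ -(p : UnitSphere n)} := by
  have := Fact.mk (@finrank_euclideanSpace_fin ℝ _ (n + 1))
  rw [extChartAt_source, TopologicalSpace.Opens.chartAt_eq,
    OpenPartialHomeomorph.subtypeRestr_source]
  have : (chartAt 𝔼 (p : UnitSphere n)).source = {-(p : UnitSphere n)}ᶜ :=
    stereographic'_source (-(p : UnitSphere n))
  rw [this]
  rfl

lemma mfderiv_ambient_extChartAt_symm (p : Ω) {y : 𝔼} (hy : y ∈ (extChartAt (𝓡 n) p).target)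
    (u : 𝔼) :
    mfderiv (𝓡 n) 𝓘(ℝ, 𝔽) (ambient (Ω := Ω)) ((extChartAt (𝓡 n) p).symm y)
      (mfderiv 𝓘(ℝ, 𝔼) (𝓡 n) (extChartAt (𝓡 n) p).symm y u)
      = invStereoDeriv (-(p : UnitSphere n)) y u := by
  have h1 := mfderiv_comp y
    ((contMDiff_ambient (Ω := Ω)).mdifferentiableAt (x := (extChartAt (𝓡 n) p).symm y) (by simp))
    (mdifferentiableAt_extChartAt_symm p hy)
  have h2 : (ambient (Ω := Ω)) ∘ (extChartAt (𝓡 n) p).symm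
      =ᶠ[𝓝 y] invStereo (-(p : UnitSphere n)) := by
    filter_upwards [(isOpen_extChartAt_target p).mem_nhds hy] with z hz
    exact ambient_extChartAt_symm p hz
  rw [← fderiv_invStereo, ← mfderiv_eq_fderiv, ← h2.mfderiv_eq, h1]
  rfl

/-- The conformal exponent in the preferred chart at `p`: the metric `e^{2f} can` reads
`e^{2w} δ` there. -/
def chartExponent (f : Ω → ℝ) (p : Ω) (y : 𝔼) : ℝ :=
  f ((extChartAt (𝓡 n) p).symm y) + Real.log (4 / (‖y‖ ^ 2 + 4))

lemma roundMetric_extChartAt_symm (p : Ω) {y : 𝔼} (hy : y ∈ (extChartAt (𝓡 n) p).target)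
    (u w : 𝔼) :
    roundMetric Ω ((extChartAt (𝓡 n) p).symm y)
      (mfderiv 𝓘(ℝ, 𝔼) (𝓡 n) (extChartAt (𝓡 n) p).symm y u)
      (mfderiv 𝓘(ℝ, 𝔼) (𝓡 n) (extChartAt (𝓡 n) p).symm y w)
      = (4 / (‖y‖ ^ 2 + 4)) ^ 2 * inner ℝ u w := by
  rw [← inner_invStereoDeriv (-(p : UnitSphere n)) y u w, ← mfderiv_ambient_extChartAt_symm p hy,
    ← mfderiv_ambient_extChartAt_symm p hy]
  rfl

lemma metricInChart_eq {g : SmoothMetric n Ω} {f : Ω → ℝ}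
    (hg : ∀ (x : Ω) (u v : TangentSpace (𝓡 n) x),
      g.inner x u v = Real.exp (2 * f x) * roundMetric Ω x u v)
    (p : Ω) {y : 𝔼} (hy : y ∈ (extChartAt (𝓡 n) p).target) :
    metricInChart g p y
      = Real.exp (2 * chartExponent f p y) • (1 : Matrix (Fin n) (Fin n) ℝ) := by
  ext i j
  simp only [metricInChart, Matrix.of_apply]
  rw [hg, roundMetric_extChartAt_symm p hy, chartExponent, mul_add, Real.exp_add,
    two_mul (Real.log _), Real.exp_add, Real.exp_log (by positivity)]
  simp [Matrix.one_apply, EuclideanSpace.inner_single_left, pow_two]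

end Chart

/-! ### Metrics conformal to the round metric -/

section ConformalMetric

variable {n : ℕ} {Ω : TopologicalSpace.Opens (UnitSphere n)}

local notation "𝔼" => EuclideanSpace ℝ (Fin n)
local notation "𝔽" => EuclideanSpace ℝ (Fin (n + 1))

lemma extChartAt_self (p : Ω) : extChartAt (𝓡 n) p p = (0 : 𝔼) := by
  have := Fact.mk (@finrank_euclideanSpace_fin ℝ _ (n + 1))
  have h : extChartAt (𝓡 n) p p = stereographic' n (-(p : UnitSphere n)) (p : UnitSphere n) := rfl
  rw [h]
  simp only [stereographic', OpenPartialHomeomorph.coe_trans, Function.comp_apply]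
  have h2 : stereographic (norm_eq_of_mem_sphere (-(p : UnitSphere n))) (p : UnitSphere n) = 0 :=
    stereographic_neg_apply _
  rw [h2]
  exact map_zero (OrthonormalBasis.fromOrthogonalSpanSingleton n
      (ne_zero_of_mem_unit_sphere (-(p : UnitSphere n)))).repr

lemma tangentCoord_eq (p : Ω) (u : TangentSpace (𝓡 n) p) : tangentCoord p u = (u : 𝔼) := by
  rw [tangentCoord, mfderiv_extChartAt_self]
  rfl

lemma mfderiv_ambient (p : Ω) {z : Ω} (hz : z ∈ (chartAt 𝔼 p).source)
    (u : TangentSpace (𝓡 n) z) :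
    mfderiv (𝓡 n) 𝓘(ℝ, 𝔽) (ambient (Ω := Ω)) z u
      = invStereoDeriv (-(p : UnitSphere n)) (extChartAt (𝓡 n) p z)
        (mfderiv (𝓡 n) 𝓘(ℝ, 𝔼) (extChartAt (𝓡 n) p) z u) := by
  have hz' : z ∈ (extChartAt (𝓡 n) p).source := by rwa [extChartAt_source]
  have h2 : ambient (Ω := Ω) =ᶠ[𝓝 z]
      invStereo (-(p : UnitSphere n)) ∘ extChartAt (𝓡 n) p := by
    filter_upwards [(isOpen_extChartAt_source p).mem_nhds hz'] with x hx
    rw [Function.comp_apply, ← ambient_extChartAt_symm p ((extChartAt (𝓡 n) p).map_source hx),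
      (extChartAt (𝓡 n) p).left_inv hx]
  have h3 := mfderiv_comp z (g := invStereo (-(p : UnitSphere n))) (f := extChartAt (𝓡 n) p)
    (I' := 𝓘(ℝ, 𝔼)) (I'' := 𝓘(ℝ, 𝔽))
    ((contDiff_invStereo _).contMDiff.mdifferentiableAt (by simp))
    (mdifferentiableAt_extChartAt hz)
  have h4 : mfderiv 𝓘(ℝ, 𝔼) 𝓘(ℝ, 𝔽) (invStereo (-(p : UnitSphere n))) (extChartAt (𝓡 n) p z)
    = fderiv ℝ (invStereo (-(p : UnitSphere n))) (extChartAt (𝓡 n) p z) := mfderiv_eq_fderiv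
  have h5 := congrArg (fun T : 𝔼 →L[ℝ] 𝔽 => T u) (h2.mfderiv_eq.trans h3)
  exact (h5.trans (congrArg (fun T : 𝔼 →L[ℝ] 𝔽 =>
    T (mfderiv (𝓡 n) 𝓘(ℝ, 𝔼) (extChartAt (𝓡 n) p) z u)) h4)).trans (fderiv_invStereo _ _ _)

lemma roundMetric_eq_chart (p : Ω) {z : Ω} (hz : z ∈ (chartAt 𝔼 p).source)
    (u w : TangentSpace (𝓡 n) z) :
    roundMetric Ω z u w = (4 / (‖extChartAt (𝓡 n) p z‖ ^ 2 + 4)) ^ 2 *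
      @inner ℝ 𝔼 _ (mfderiv (𝓡 n) 𝓘(ℝ, 𝔼) (extChartAt (𝓡 n) p) z u)
        (mfderiv (𝓡 n) 𝓘(ℝ, 𝔼) (extChartAt (𝓡 n) p) z w) := by
  refine Eq.trans ?_ (inner_invStereoDeriv (-(p : UnitSphere n)) _ _ _)
  exact congrArg₂ (@inner ℝ 𝔽 _) (mfderiv_ambient p hz u) (mfderiv_ambient p hz w)

/-- The preferred chart at `p` is centred at `p` and isometric there. -/
lemma roundMetric_eq_inner (p : Ω) (u w : TangentSpace (𝓡 n) p) :
    roundMetric Ω p u w = @inner ℝ 𝔼 _ u w := by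
  have h0 : ‖extChartAt (𝓡 n) p p‖ = 0 := by rw [extChartAt_self, norm_zero]
  have h1 : ∀ u : TangentSpace (𝓡 n) p,
      mfderiv (𝓡 n) 𝓘(ℝ, 𝔼) (extChartAt (𝓡 n) p) p u = u := by
    intro u
    rw [mfderiv_extChartAt_self]
    rfl
  rw [roundMetric_eq_chart p (mem_chart_source 𝔼 p), h0, h1, h1]
  norm_num

variable (n) in
/-- The scalar product of `ℝⁿ` as a continuous bilinear map. -/
def euclideanForm : 𝔼 →L[ℝ] 𝔼 →L[ℝ] ℝ := innerSL ℝ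

variable (n) in
/-- The scalar product of `ℝⁿ`, seen as a bilinear form on a tangent space. -/
def tangentForm (x : Ω) : TangentSpace (𝓡 n) x →L[ℝ] TangentSpace (𝓡 n) x →L[ℝ] ℝ :=
  euclideanForm n

lemma tangentForm_apply (x : Ω) (u w : TangentSpace (𝓡 n) x) :
    tangentForm n x u w = @inner ℝ 𝔼 _ u w := rfl

lemma contMDiffAt_smul_const {V : Type*} [NormedAddCommGroup V] [NormedSpace ℝ V] (c : V)
    {φ : Ω → ℝ} {x : Ω} (h : ContMDiffAt (𝓡 n) 𝓘(ℝ, ℝ) ∞ φ x) :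
    ContMDiffAt (𝓡 n) 𝓘(ℝ, V) ∞ (fun y => φ y • c) x :=
  h.smul contMDiffAt_const

lemma contMDiffAt_smul_euclideanForm (f : Ω → ℝ) (hf : ContMDiff (𝓡 n) 𝓘(ℝ, ℝ) ∞ f) (x₀ : Ω) :
    ContMDiffAt (𝓡 n) 𝓘(ℝ, 𝔼 →L[ℝ] 𝔼 →L[ℝ] ℝ) ∞ (fun x : Ω =>
      (Real.exp (2 * f x) * (4 / (‖extChartAt (𝓡 n) x₀ x‖ ^ 2 + 4)) ^ 2) • euclideanForm n) x₀ := by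
  have h1 : ContDiff ℝ ∞ fun y : 𝔼 => (4 / (‖y‖ ^ 2 + 4)) ^ 2 :=
    (contDiff_const.div ((contDiff_norm_sq ℝ).add contDiff_const) fun x => by positivity).pow 2
  have h2 : ContMDiffAt (𝓡 n) 𝓘(ℝ, ℝ) ∞
      (fun x : Ω => (4 / (‖extChartAt (𝓡 n) x₀ x‖ ^ 2 + 4)) ^ 2) x₀ :=
    h1.contMDiff.contMDiffAt.comp x₀ contMDiffAt_extChartAt
  have h3 : ContMDiffAt (𝓡 n) 𝓘(ℝ, ℝ) ∞ (fun x : Ω => Real.exp (2 * f x)) x₀ :=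
    (Real.contDiff_exp.comp (contDiff_const.mul contDiff_id)).contMDiff.contMDiffAt.comp x₀
      (hf x₀)
  have h4 : ContMDiffAt (𝓡 n) 𝓘(ℝ, ℝ) ∞ (fun x : Ω =>
      Real.exp (2 * f x) * (4 / (‖extChartAt (𝓡 n) x₀ x‖ ^ 2 + 4)) ^ 2) x₀ := h3.mul h2
  exact contMDiffAt_smul_const _ h4

lemma roundMetric_symmL (x₀ : Ω) {x : Ω} (hx : x ∈ (chartAt 𝔼 x₀).source) (u v : 𝔼) :
    roundMetric Ω x ((trivializationAt 𝔼 (fun x : Ω => TangentSpace (𝓡 n) x) x₀).symm x u)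
      ((trivializationAt 𝔼 (fun x : Ω => TangentSpace (𝓡 n) x) x₀).symm x v)
      = (4 / (‖extChartAt (𝓡 n) x₀ x‖ ^ 2 + 4)) ^ 2 * inner ℝ u v := by
  have hd : ∀ u : 𝔼, mfderiv (𝓡 n) 𝓘(ℝ, 𝔼) (extChartAt (𝓡 n) x₀) x
      ((trivializationAt 𝔼 (fun x : Ω => TangentSpace (𝓡 n) x) x₀).symm x u) = u := by
    intro u
    rw [← TangentBundle.continuousLinearMapAt_trivializationAt hx,
      ← Trivialization.symmL_apply (R := ℝ) _ (by simpa using hx)]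
    exact (trivializationAt 𝔼 (fun x : Ω => TangentSpace (𝓡 n) x) x₀).continuousLinearMapAt_symmL
      (R := ℝ) (by simpa using hx) u
  rw [roundMetric_eq_chart x₀ hx, hd, hd]

lemma inCoordinates_tangentForm (x₀ : Ω) {x : Ω} (hx : x ∈ (chartAt 𝔼 x₀).source)
    (ϕ : TangentSpace (𝓡 n) x →L[ℝ] TangentSpace (𝓡 n) x →L[ℝ] ℝ) (u v : 𝔼) :
    ContinuousLinearMap.inCoordinates 𝔼 (fun x : Ω => TangentSpace (𝓡 n) x) (𝔼 →L[ℝ] ℝ)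
      (fun x : Ω => TangentSpace (𝓡 n) x →L[ℝ] ℝ) x₀ x x₀ x ϕ u v
      = ϕ ((trivializationAt 𝔼 (fun x : Ω => TangentSpace (𝓡 n) x) x₀).symm x u)
        ((trivializationAt 𝔼 (fun x : Ω => TangentSpace (𝓡 n) x) x₀).symm x v) := by
  have h := inCoordinates_apply_eq₂ (𝕜 := ℝ) (F₁ := 𝔼) (F₂ := 𝔼) (F₃ := ℝ)
    (E₁ := fun x : Ω => TangentSpace (𝓡 n) x) (E₂ := fun x : Ω => TangentSpace (𝓡 n) x)
    (E₃ := Bundle.Trivial Ω ℝ) (x₀ := x₀) (x := x) (ϕ := ϕ) (v := u) (w := v)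
    (by simpa using hx) (by simpa using hx) (by simp)
  exact h.trans (congrArg (fun L : ℝ →ₗ[ℝ] ℝ => L _)
    (Bundle.Trivial.linearMapAt_trivialization ℝ Ω ℝ x))

/-- The form `tangentForm` looks constant, but its smoothness is a statement about the transition to
a fixed trivialization near `x₀`, in which the metric is `(4 / (|y|² + 4))²` times the scalar
product. -/
lemma contMDiff_smul_tangentForm (f : Ω → ℝ) (hf : ContMDiff (𝓡 n) 𝓘(ℝ, ℝ) ∞ f) :
    ContMDiff (𝓡 n) ((𝓡 n).prod 𝓘(ℝ, 𝔼 →L[ℝ] 𝔼 →L[ℝ] ℝ)) ∞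
      (fun x : Ω => TotalSpace.mk' (𝔼 →L[ℝ] 𝔼 →L[ℝ] ℝ)
        (E := fun x : Ω => TangentSpace (𝓡 n) x →L[ℝ] TangentSpace (𝓡 n) x →L[ℝ] ℝ) x
        (Real.exp (2 * f x) • tangentForm n x)) := by
  intro x₀
  refine (contMDiffAt_section (s := fun x => Real.exp (2 * f x) • tangentForm n x) x₀).2 ?_
  have hsm := contMDiffAt_smul_euclideanForm f hf x₀
  refine hsm.congr_of_eventuallyEq ?_
  filter_upwards [chart_source_mem_nhds 𝔼 x₀] with x hx
  have hr := roundMetric_symmL x₀ hx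
  refine ContinuousLinearMap.ext fun u => ContinuousLinearMap.ext fun v => ?_
  refine (inCoordinates_tangentForm x₀ hx _ u v).trans ?_
  change Real.exp (2 * f x) * @inner ℝ 𝔼 _ _ _ = _
  rw [← roundMetric_eq_inner, hr, ← mul_assoc]
  rfl

/-- The conformal metric `e^{2f} can` on a domain of the sphere. The tangent space at `x` is the
model space `ℝⁿ`, by means of the preferred chart at `x`, and `can` is the scalar product of `ℝⁿ`
there (`roundMetric_eq_inner`). -/
def conformalMetric (f : Ω → ℝ) (hf : ContMDiff (𝓡 n) 𝓘(ℝ, ℝ) ∞ f) : SmoothMetric n Ω where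
  inner x := Real.exp (2 * f x) • tangentForm n x
  symm x v w := by
    simp only [smul_apply, tangentForm_apply]
    exact congrArg _ (real_inner_comm _ _)
  pos x v hv := by
    simp only [smul_apply, tangentForm_apply]
    exact mul_pos (Real.exp_pos _) (real_inner_self_pos.2 hv)
  isVonNBounded x := by
    change Bornology.IsVonNBounded ℝ {v : 𝔼 | Real.exp (2 * f x) * inner ℝ v v < 1}
    refine (NormedSpace.isVonNBounded_ball ℝ 𝔼 (Real.exp (-f x))).subset fun v hv => ?_
    rw [mem_ball_zero_iff]
    have h1 : Real.exp (2 * f x) * inner ℝ v v < 1 := hv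
    have h2 : (Real.exp (f x) * ‖v‖) ^ 2 < 1 := by
      rw [mul_pow, ← Real.exp_nat_mul, ← real_inner_self_eq_norm_sq]
      exact_mod_cast h1
    have h3 : Real.exp (f x) * ‖v‖ < 1 := by
      refine lt_of_pow_lt_pow_left₀ 2 zero_le_one ?_
      simpa using h2
    rw [Real.exp_neg, ← one_div, lt_div_iff₀ (Real.exp_pos _), mul_comm]
    exact h3
  contMDiff := by
    exact contMDiff_smul_tangentForm f hf

lemma conformalMetric_inner (f : Ω → ℝ) (hf : ContMDiff (𝓡 n) 𝓘(ℝ, ℝ) ∞ f) (x : Ω)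
    (u v : TangentSpace (𝓡 n) x) :
    (conformalMetric f hf).inner x u v = Real.exp (2 * f x) * roundMetric Ω x u v := by
  rw [roundMetric_eq_inner]
  rfl

end ConformalMetric

/-! ### A completeness criterion -/

section Complete

variable {n : ℕ} {M : Type*} [TopologicalSpace M]
  [ChartedSpace (EuclideanSpace ℝ (Fin n)) M] [IsManifold (𝓡 n) ∞ M]

/-- A Riemannian manifold is complete as soon as it carries a proper function with bounded
gradient: along a Cauchy sequence such a function is bounded, so that the sequence stays in a
compact set. -/
lemma isCompleteMetric_of_proper [RegularSpace M] (g : SmoothMetric n M) {f : M → ℝ}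
    (hf : ContMDiff (𝓡 n) 𝓘(ℝ, ℝ) 1 f) (hK : ∀ c, IsCompact {x | f x ≤ c}) {C : ℝ}
    (hC : ∀ (x : M) (u : TangentSpace (𝓡 n) x),
      @abs ℝ _ _ (mfderiv (𝓡 n) 𝓘(ℝ, ℝ) f x u) ≤ C * Real.sqrt (g.inner x u u)) :
    IsCompleteMetric g := by
  unfold IsCompleteMetric
  let : RiemannianBundle (fun x : M => TangentSpace (𝓡 n) x) := ⟨g.toRiemannianMetric⟩
  have : IsContinuousRiemannianBundle (EuclideanSpace ℝ (Fin n))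
      (fun x : M => TangentSpace (𝓡 n) x) :=
    ⟨g.inner, g.contMDiff.continuous, fun _ _ _ => rfl⟩
  let : PseudoEMetricSpace M := PseudoEMetricSpace.ofRiemannianMetric (𝓡 n) M
  change CompleteSpace M
  have hnorm : ∀ (x : M) (u : TangentSpace (𝓡 n) x), ‖u‖ = Real.sqrt (g.inner x u u) := by
    intro x u
    rw [norm_eq_sqrt_real_inner]
    rfl
  -- Integrate the gradient bound along a path of length less than one.
  have hlip : ∀ x y : M, edist x y < 1 → f y ≤ f x + |C| := by
    intro x y hxy
    have hxy' : Manifold.riemannianEDist (𝓡 n) x y < 1 := hxy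
    obtain ⟨γ, hγ0, hγ1, hγ, hlen⟩  := Manifold.exists_lt_of_riemannianEDist_lt hxy'
    have D : ContDiffOn ℝ 1 (f ∘ γ) (Icc 0 1) := by
      rw [← contMDiffOn_iff_contDiffOn]
      exact hf.comp_contMDiffOn hγ
    have h1 := enorm_sub_le_lintegral_derivWithin_Icc_of_contDiffOn_Icc D zero_le_one
    have h2 : ∫⁻ t in Icc (0 : ℝ) 1, ‖derivWithin (f ∘ γ) (Icc 0 1) t‖ₑ
        ≤ ENNReal.ofReal |C| * Manifold.pathELength (𝓡 n) γ 0 1 := by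
      rw [Manifold.pathELength_eq_lintegral_mfderivWithin_Icc,
        ← lintegral_const_mul' _ _ ENNReal.ofReal_ne_top]
      refine setLIntegral_mono' measurableSet_Icc fun t ht => ?_
      have hcomp : mfderivWithin 𝓘(ℝ, ℝ) 𝓘(ℝ, ℝ) (f ∘ γ) (Icc 0 1) t
          = (mfderiv (𝓡 n) 𝓘(ℝ, ℝ) f (γ t)).comp
            (mfderivWithin 𝓘(ℝ, ℝ) (𝓡 n) γ (Icc 0 1) t) := by
        apply mfderiv_comp_mfderivWithin
        · exact hf.mdifferentiableAt one_ne_zero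
        · exact hγ.mdifferentiableOn one_ne_zero t ht
        · rw [uniqueMDiffWithinAt_iff_uniqueDiffWithinAt]
          exact uniqueDiffOn_Icc zero_lt_one t ht
      have hd : derivWithin (f ∘ γ) (Icc 0 1) t
          = mfderiv (𝓡 n) 𝓘(ℝ, ℝ) f (γ t) (mfderivWithin 𝓘(ℝ, ℝ) (𝓡 n) γ (Icc 0 1) t 1) := by
        rw [← fderivWithin_derivWithin, ← mfderivWithin_eq_fderivWithin, hcomp]
        rfl
      have hb : ‖derivWithin (f ∘ γ) (Icc 0 1) t‖
          ≤ |C| * ‖mfderivWithin 𝓘(ℝ, ℝ) (𝓡 n) γ (Icc 0 1) t 1‖ := by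
        rw [hnorm, hd]
        refine (hC _ _).trans ?_
        gcongr
        exact le_abs_self C
      rw [← ofReal_norm, ← ofReal_norm, ← ENNReal.ofReal_mul (abs_nonneg _)]
      exact ENNReal.ofReal_le_ofReal hb
    have h3 : ‖(f ∘ γ) 1 - (f ∘ γ) 0‖ₑ ≤ ENNReal.ofReal |C| := by
      refine (h1.trans h2).trans ?_
      calc _ ≤ ENNReal.ofReal |C| * 1 := by gcongr
        _ = _ := mul_one _
    rw [Function.comp_apply, Function.comp_apply, hγ0, hγ1, ← ofReal_norm,
      ENNReal.ofReal_le_ofReal_iff (abs_nonneg _), Real.norm_eq_abs] at h3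
    linarith [le_abs_self (f y - f x)]
  refine ⟨fun {F} hF => ?_⟩
  obtain ⟨hne, h⟩ := EMetric.cauchy_iff.1 hF
  obtain ⟨t, htF, ht⟩ := h 1 one_pos
  have := hF.1
  obtain ⟨x, hx⟩ := Filter.nonempty_of_mem htF
  have hsub : t ⊆ {y | f y ≤ f x + |C|} := fun y hy => hlip x y (ht x hx y hy)
  obtain ⟨z, -, hz⟩ := (hK (f x + |C|)).isComplete F hF
    (Filter.le_principal_iff.2 (Filter.mem_of_superset htF hsub))
  exact ⟨z, hz⟩

end Complete

/-! ### The Riemannian volume in a chart that covers the manifold -/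

section Volume

variable {n : ℕ} {M : Type*} [TopologicalSpace M]
  [ChartedSpace (EuclideanSpace ℝ (Fin n)) M]

local notation "𝔼" => EuclideanSpace ℝ (Fin n)

variable (M) in
/-- The change of coordinates from the chart at `p` to the chart at `q`. -/
def chartTransition (p q : M) : 𝔼 → 𝔼 := extChartAt (𝓡 n) q ∘ (extChartAt (𝓡 n) p).symm

lemma symm_chartTransition {p q : M} (hq : (extChartAt (𝓡 n) q).source = univ) (y : 𝔼) :
    (extChartAt (𝓡 n) q).symm (chartTransition M p q y) = (extChartAt (𝓡 n) p).symm y :=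
  (extChartAt (𝓡 n) q).left_inv (hq ▸ mem_univ _)

lemma measurableSet_chart_preimage [MeasurableSpace M] [BorelSpace M] (p : M) {s : Set M}
    (hs : MeasurableSet s) :
    MeasurableSet ((extChartAt (𝓡 n) p).target ∩ (extChartAt (𝓡 n) p).symm ⁻¹' s) := by
  have h1 : Measurable ((extChartAt (𝓡 n) p).target.domRestrict (extChartAt (𝓡 n) p).symm) :=
    (continuousOn_iff_continuous_domRestrict.1 (continuousOn_extChartAt_symm p)).measurable
  have h2 := (isOpen_extChartAt_target (I := 𝓡 n) p).measurableSet.subtype_image (h1 hs)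
  convert! h2 using 1
  ext y
  constructor
  · rintro ⟨h, h'⟩
    exact ⟨⟨y, h⟩, h', rfl⟩
  · rintro ⟨⟨z, h⟩, h', rfl⟩
    exact ⟨h, h'⟩

lemma aemeasurable_extChartAt_symm [MeasurableSpace M] [BorelSpace M] (p : M)
    {μ : Measure 𝔼} :
    AEMeasurable (extChartAt (𝓡 n) p).symm (μ.restrict (extChartAt (𝓡 n) p).target) :=
  (continuousOn_extChartAt_symm p).aemeasurable (isOpen_extChartAt_target p).measurableSet

variable [IsManifold (𝓡 n) ∞ M]

lemma differentiableAt_chartTransition {p q : M} (hq : (extChartAt (𝓡 n) q).source = univ) {y : 𝔼}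
    (hy : y ∈ (extChartAt (𝓡 n) p).target) : DifferentiableAt ℝ (chartTransition M p q) y := by
  rw [← mdifferentiableAt_iff_differentiableAt]
  refine MDifferentiableAt.comp y (I' := 𝓡 n) (mdifferentiableAt_extChartAt ?_)
    (mdifferentiableAt_extChartAt_symm p hy)
  rw [← extChartAt_source (𝓡 n), hq]
  exact mem_univ _

lemma mfderiv_symm_chartTransition {p q : M} (hq : (extChartAt (𝓡 n) q).source = univ) {y : 𝔼}
    (hy : y ∈ (extChartAt (𝓡 n) p).target) (u : 𝔼) :
    mfderiv 𝓘(ℝ, 𝔼) (𝓡 n) (extChartAt (𝓡 n) p).symm y u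
      = mfderiv 𝓘(ℝ, 𝔼) (𝓡 n) (extChartAt (𝓡 n) q).symm (chartTransition M p q y)
        (fderiv ℝ (chartTransition M p q) y u) := by
  have h : (extChartAt (𝓡 n) p).symm = (extChartAt (𝓡 n) q).symm ∘ chartTransition M p q :=
    funext fun z => (symm_chartTransition hq z).symm
  have hy' : chartTransition M p q y ∈ (extChartAt (𝓡 n) q).target :=
    (extChartAt (𝓡 n) q).map_source (hq ▸ mem_univ _)
  have h1 := mfderiv_comp y (mdifferentiableAt_extChartAt_symm q hy')
    (differentiableAt_chartTransition hq hy).mdifferentiableAt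
  rw [mfderiv_eq_fderiv, ← h] at h1
  exact congrArg (fun L : 𝔼 →L[ℝ] 𝔼 => L u) h1

/-- The metric in the chart at `p`, as a bilinear form on `ℝⁿ`. -/
def chartForm (g : SmoothMetric n M) (p : M) (y : 𝔼) : 𝔼 →L[ℝ] 𝔼 →L[ℝ] ℝ :=
  let B : 𝔼 →L[ℝ] 𝔼 →L[ℝ] ℝ := g.inner ((extChartAt (𝓡 n) p).symm y)
  let D : 𝔼 →L[ℝ] 𝔼 := mfderiv 𝓘(ℝ, 𝔼) (𝓡 n) (extChartAt (𝓡 n) p).symm y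
  B.bilinearComp D D

lemma metricInChart_apply (g : SmoothMetric n M) (p : M) (y : 𝔼) (i j : Fin n) :
    metricInChart g p y i j
      = chartForm g p y (EuclideanSpace.single i 1) (EuclideanSpace.single j 1) := rfl

lemma chartForm_transition (g : SmoothMetric n M) {p q : M}
    (hq : (extChartAt (𝓡 n) q).source = univ) {y : 𝔼} (hy : y ∈ (extChartAt (𝓡 n) p).target)
    (u v : 𝔼) :
    chartForm g p y u v = chartForm g q (chartTransition M p q y)
      (fderiv ℝ (chartTransition M p q) y u) (fderiv ℝ (chartTransition M p q) y v) := by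
  have hB : ∀ (x x' : M), x = x' → (g.inner x : 𝔼 →L[ℝ] 𝔼 →L[ℝ] ℝ) = g.inner x' := by
    rintro x _ rfl
    rfl
  have hx := hB _ _ (symm_chartTransition (p := p) hq y)
  have hu := mfderiv_symm_chartTransition hq hy u
  have hv := mfderiv_symm_chartTransition hq hy v
  change (g.inner ((extChartAt (𝓡 n) p).symm y) : 𝔼 →L[ℝ] 𝔼 →L[ℝ] ℝ)
    (mfderiv 𝓘(ℝ, 𝔼) (𝓡 n) (extChartAt (𝓡 n) p).symm y u)
    (mfderiv 𝓘(ℝ, 𝔼) (𝓡 n) (extChartAt (𝓡 n) p).symm y v) = _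
  exact (congrArg₂ (fun a b : 𝔼 => (g.inner ((extChartAt (𝓡 n) p).symm y) :
    𝔼 →L[ℝ] 𝔼 →L[ℝ] ℝ) a b) hu hv).trans (congrArg (fun B : 𝔼 →L[ℝ] 𝔼 →L[ℝ] ℝ => B _ _) hx.symm)

/-- The transformation law of the metric under a change of coordinates. -/
lemma metricInChart_transition (g : SmoothMetric n M) {p q : M}
    (hq : (extChartAt (𝓡 n) q).source = univ) {y : 𝔼} (hy : y ∈ (extChartAt (𝓡 n) p).target) :
    let J := LinearMap.toMatrix (EuclideanSpace.basisFun (Fin n) ℝ).toBasis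
      (EuclideanSpace.basisFun (Fin n) ℝ).toBasis (fderiv ℝ (chartTransition M p q) y).toLinearMap
    metricInChart g p y = J.transpose * metricInChart g q (chartTransition M p q y) * J := by
  intro J
  ext i j
  have hJ : ∀ i, fderiv ℝ (chartTransition M p q) y (EuclideanSpace.single i 1)
      = ∑ k, J k i • EuclideanSpace.single k (1 : ℝ) := by
    intro i
    ext l
    simp [J, LinearMap.toMatrix_apply, Pi.single_apply]
  rw [metricInChart_apply, chartForm_transition g hq hy, hJ, hJ]
  generalize hβ : chartForm g q (chartTransition M p q y) = β
  simp only [map_sum, map_smul, sum_apply, smul_apply, smul_eq_mul, Matrix.mul_apply,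
    Matrix.transpose_apply, metricInChart_apply, hβ, Finset.mul_sum, Finset.sum_mul]
  refine Finset.sum_congr rfl fun k _ => Finset.sum_congr rfl fun l _ => ?_
  ring

lemma sqrt_det_metricInChart_transition (g : SmoothMetric n M) {p q : M}
    (hq : (extChartAt (𝓡 n) q).source = univ) {y : 𝔼} (hy : y ∈ (extChartAt (𝓡 n) p).target) :
    ENNReal.ofReal (Real.sqrt (metricInChart g p y).det)
      = ENNReal.ofReal |(fderiv ℝ (chartTransition M p q) y).det| *
        ENNReal.ofReal (Real.sqrt (metricInChart g q (chartTransition M p q y)).det) := by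
  rw [metricInChart_transition g hq hy, Matrix.det_mul, Matrix.det_mul, Matrix.det_transpose,
    LinearMap.det_toMatrix, ← ENNReal.ofReal_mul (abs_nonneg _)]
  congr 1
  rw [mul_comm, ← mul_assoc, ← pow_two, Real.sqrt_mul (sq_nonneg _), Real.sqrt_sq_eq_abs]

variable [MeasurableSpace M] [BorelSpace M]

lemma chartVolume_apply (g : SmoothMetric n M) (p : M) {s : Set M} (hs : MeasurableSet s) :
    chartVolume g p s = ∫⁻ y in (extChartAt (𝓡 n) p).target ∩ (extChartAt (𝓡 n) p).symm ⁻¹' s,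
      ENNReal.ofReal (Real.sqrt (metricInChart g p y).det) := by
  have ht : MeasurableSet (extChartAt (𝓡 n) p).target :=
    (isOpen_extChartAt_target p).measurableSet
  rw [chartVolume, Measure.map_apply_of_aemeasurable _ hs]
  · rw [← restrict_withDensity ht, Measure.restrict_apply' ht, inter_comm,
      withDensity_apply _ (measurableSet_chart_preimage p hs)]
  · exact (aemeasurable_extChartAt_symm p).mono_ac (withDensity_absolutelyContinuous _ _)

/-- By the change of variables formula, the chart at `q` sees the volume of every other chart. -/
lemma chartVolume_le (g : SmoothMetric n M) (p q : M)
    (hq : (extChartAt (𝓡 n) q).source = univ) : chartVolume g p ≤ chartVolume g q := by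
  rw [Measure.le_iff]
  intro s hs
  rw [chartVolume_apply g p hs, chartVolume_apply g q hs]
  set S := (extChartAt (𝓡 n) p).target ∩ (extChartAt (𝓡 n) p).symm ⁻¹' s with hS
  have hSm : MeasurableSet S := measurableSet_chart_preimage p hs
  have hinj : InjOn (chartTransition M p q) S := by
    intro y hy z hz h
    have := congrArg (extChartAt (𝓡 n) q).symm h
    rw [symm_chartTransition hq, symm_chartTransition hq] at this
    exact (extChartAt (𝓡 n) p).symm.injOn hy.1 hz.1 this
  rw [setLIntegral_congr_fun hSm fun y hy => sqrt_det_metricInChart_transition g hq hy.1,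
    ← lintegral_image_eq_lintegral_abs_det_fderiv_mul volume hSm
      (fun y hy => (differentiableAt_chartTransition hq hy.1).hasFDerivAt.hasFDerivWithinAt) hinj
      (fun y => ENNReal.ofReal (Real.sqrt (metricInChart g q y).det))]
  refine lintegral_mono_set ?_
  rintro _ ⟨y, hy, rfl⟩
  refine ⟨(extChartAt (𝓡 n) q).map_source (hq ▸ mem_univ _), ?_⟩
  rw [mem_preimage, symm_chartTransition hq]
  exact hy.2

/-- If one chart covers the manifold, integrals over the Riemannian volume are bounded by integrals
over this chart. -/
lemma lintegral_riemannianVolume_le [SecondCountableTopology M] (g : SmoothMetric n M) (q : M)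
    (hq : (extChartAt (𝓡 n) q).source = univ)
    {d : 𝔼 → ℝ≥0∞} (hd : Measurable d) (hdq : ∀ y ∈ (extChartAt (𝓡 n) q).target,
      ENNReal.ofReal (Real.sqrt (metricInChart g q y).det) = d y) (F : M → ℝ≥0∞) :
    ∫⁻ x, F x ∂(riemannianVolume g) ≤ ∫⁻ y in (extChartAt (𝓡 n) q).target,
      d y * F ((extChartAt (𝓡 n) q).symm y) := by
  have h1 : riemannianVolume g ≤ chartVolume g q := iSup_le fun p => chartVolume_le g p q hq
  refine (lintegral_mono' h1 le_rfl).trans ((lintegral_map_le _ _).trans ?_)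
  have h2 : ((volume : Measure 𝔼).restrict (extChartAt (𝓡 n) q).target).withDensity
      (fun y => ENNReal.ofReal (Real.sqrt (metricInChart g q y).det))
      = ((volume : Measure 𝔼).restrict (extChartAt (𝓡 n) q).target).withDensity d :=
    withDensity_congr_ae ((ae_restrict_iff' (isOpen_extChartAt_target q).measurableSet).2
      (Filter.Eventually.of_forall hdq))
  rw [h2]
  exact lintegral_withDensity_le_lintegral_mul _ hd _

end Volume

/-! ### The profile of a long neck -/

section Profile

/-- A smooth concave function that vanishes on `[1, ∞)` and has slope one on `(-∞, 0]`. -/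
def smoothCap (x : ℝ) : ℝ := ∫ t in (1 : ℝ)..x, (1 - Real.smoothTransition t)

lemma continuous_one_sub_smoothTransition : Continuous fun t => 1 - Real.smoothTransition t :=
  continuous_const.sub Real.smoothTransition.continuous

lemma hasDerivAt_smoothCap (x : ℝ) : HasDerivAt smoothCap (1 - Real.smoothTransition x) x :=
  intervalIntegral.integral_hasDerivAt_right
    (continuous_one_sub_smoothTransition.intervalIntegrable _ _)
    (continuous_one_sub_smoothTransition.stronglyMeasurableAtFilter _ _)
    continuous_one_sub_smoothTransition.continuousAt

lemma contDiff_smoothCap : ContDiff ℝ ∞ smoothCap := by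
  rw [contDiff_infty_iff_deriv]
  refine ⟨fun x => (hasDerivAt_smoothCap x).differentiableAt, ?_⟩
  rw [funext fun x => (hasDerivAt_smoothCap x).deriv]
  exact contDiff_const.sub Real.smoothTransition.contDiff

lemma smoothCap_of_one_le {x : ℝ} (hx : 1 ≤ x) : smoothCap x = 0 := by
  rw [smoothCap, intervalIntegral.integral_congr (g := fun _ => (0 : ℝ))]
  · simp
  · intro t ht
    rw [uIcc_of_le hx] at ht
    simp [Real.smoothTransition.one_of_one_le ht.1]

lemma smoothCap_nonpos (x : ℝ) : smoothCap x ≤ 0 := by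
  rcases le_total 1 x with hx | hx
  · exact (smoothCap_of_one_le hx).le
  · rw [smoothCap, intervalIntegral.integral_symm, neg_nonpos]
    exact intervalIntegral.integral_nonneg hx fun t _ =>
      sub_nonneg.2 (Real.smoothTransition.le_one t)

/-- On `(-∞, 0]` the function is `x + smoothCap 0`, and `smoothCap 0 ≤ 0`. -/
lemma smoothCap_le (x : ℝ) : smoothCap x ≤ x := by
  rcases le_total 0 x with hx | hx
  · exact (smoothCap_nonpos x).trans hx
  · have hi : ∀ a b, IntervalIntegrable (fun t => 1 - Real.smoothTransition t) volume a b :=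
      fun a b => continuous_one_sub_smoothTransition.intervalIntegrable a b
    have h1 : smoothCap x = smoothCap 0 + ∫ t in (0 : ℝ)..x, (1 - Real.smoothTransition t) :=
      (intervalIntegral.integral_add_adjacent_intervals (hi _ _) (hi _ _)).symm
    have h2 : ∫ t in (0 : ℝ)..x, (1 - Real.smoothTransition t) = x := by
      rw [intervalIntegral.integral_congr (g := fun _ => (1 : ℝ))]
      · simp
      · intro t ht
        rw [uIcc_of_ge hx] at ht
        simp [Real.smoothTransition.zero_of_nonpos ht.2]
    linarith [smoothCap_nonpos 0]

/-- The logarithmic profile of a neck of length parameter `l`: with `τ = log |y|²`, the metric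
`e^{-2 φ(τ)} |dy|²` is flat where `τ ≥ l`, is a cylinder where `τ ≤ 0`, and passes from the one to
the other with a second derivative of size `1 / l`. -/
def neckProfile (l t : ℝ) : ℝ := l / 2 * smoothCap (t / l)

/-- The derivative of `neckProfile l`. -/
def neckSlope (l t : ℝ) : ℝ := (1 - Real.smoothTransition (t / l)) / 2

/-- The second derivative of `neckProfile l`. -/
def neckBend (l t : ℝ) : ℝ := -(deriv Real.smoothTransition (t / l) / (2 * l))

variable {l t : ℝ}

lemma contDiff_neckProfile (l : ℝ) : ContDiff ℝ ∞ (neckProfile l) :=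
  contDiff_const.mul (contDiff_smoothCap.comp (contDiff_id.div_const l))

lemma hasDerivAt_neckProfile (hl : 0 < l) (t : ℝ) :
    HasDerivAt (neckProfile l) (neckSlope l t) t := by
  have h := (((hasDerivAt_smoothCap (t / l)).comp t ((hasDerivAt_id t).div_const l)).const_mul
    (l / 2))
  refine h.congr_deriv ?_
  rw [neckSlope]
  field_simp

lemma hasDerivAt_neckSlope (l t : ℝ) : HasDerivAt (neckSlope l) (neckBend l t) t := by
  have hd : HasDerivAt Real.smoothTransition (deriv Real.smoothTransition (t / l)) (t / l) :=
    ((Real.smoothTransition.contDiff (n := 1)).differentiable one_ne_zero _).hasDerivAt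
  refine (((hd.comp t ((hasDerivAt_id t).div_const l)).const_sub 1).div_const 2).congr_deriv ?_
  rw [neckBend]
  ring

lemma neckProfile_nonpos (hl : 0 < l) (t : ℝ) : neckProfile l t ≤ 0 :=
  mul_nonpos_of_nonneg_of_nonpos (by positivity) (smoothCap_nonpos _)

lemma neckProfile_of_le (hl : 0 < l) (ht : l ≤ t) : neckProfile l t = 0 := by
  rw [neckProfile, smoothCap_of_one_le ((one_le_div hl).2 ht), mul_zero]

/-- In terms of `s = e^t`, this says `e^{2 φ} ≤ s`: the conformal factor `e^{-2 φ}` of the neck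
dominates that of a cylinder, `1 / s`. -/
lemma two_mul_neckProfile_le (hl : 0 < l) (t : ℝ) : 2 * neckProfile l t ≤ t := by
  have h := mul_le_mul_of_nonneg_left (smoothCap_le (t / l)) hl.le
  rw [mul_div_cancel₀ _ hl.ne'] at h
  rw [neckProfile]
  linarith

lemma neckSlope_nonneg (l t : ℝ) : 0 ≤ neckSlope l t :=
  div_nonneg (sub_nonneg.2 (Real.smoothTransition.le_one _)) two_pos.le

lemma neckSlope_le_one (l t : ℝ) : neckSlope l t ≤ 1 := by
  have := Real.smoothTransition.nonneg (t / l)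
  rw [neckSlope]
  linarith

lemma deriv_smoothTransition_of_notMem {x : ℝ} (hx : x ∉ Icc (0 : ℝ) 1) :
    deriv Real.smoothTransition x = 0 := by
  rw [mem_Icc, not_and_or, not_le, not_le] at hx
  rcases hx with hx | hx
  · have : Real.smoothTransition =ᶠ[𝓝 x] fun _ => 0 := by
      filter_upwards [Iio_mem_nhds hx] with t ht
      exact Real.smoothTransition.zero_of_nonpos (le_of_lt ht)
    rw [this.deriv_eq]; simp
  · have : Real.smoothTransition =ᶠ[𝓝 x] fun _ => 1 := by
      filter_upwards [Ioi_mem_nhds hx] with t ht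
      exact Real.smoothTransition.one_of_one_le (le_of_lt ht)
    rw [this.deriv_eq]; simp

lemma neckBend_of_notMem (hl : 0 < l) (ht : t ∉ Icc 0 l) : neckBend l t = 0 := by
  rw [neckBend, deriv_smoothTransition_of_notMem]
  · simp
  · rintro ⟨h0, h1⟩
    exact ht ⟨by simpa [hl.ne'] using mul_nonneg h0 hl.le, (div_le_one hl).1 h1⟩

lemma exists_abs_neckBend_le : ∃ B : ℝ, 0 < B ∧ ∀ l t : ℝ, 0 < l → |neckBend l t| ≤ B / l := by
  have hc : Continuous (deriv Real.smoothTransition) :=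
    (Real.smoothTransition.contDiff (n := 1)).continuous_deriv le_rfl
  obtain ⟨B, hB⟩ := (isCompact_Icc (a := (0 : ℝ)) (b := 1)).exists_bound_of_continuousOn
    hc.continuousOn
  have hB' : ∀ x, |deriv Real.smoothTransition x| ≤ max B 1 := by
    intro x
    by_cases hx : x ∈ Icc (0 : ℝ) 1
    · exact (hB x hx).trans (le_max_left _ _)
    · rw [deriv_smoothTransition_of_notMem hx, abs_zero]
      positivity
  refine ⟨max B 1, by positivity, fun l t hl => ?_⟩
  rw [neckBend, abs_neg, abs_div, abs_of_pos (by positivity : 0 < 2 * l)]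
  have h := hB' (t / l)
  have h0 : 0 < max B 1 := by positivity
  gcongr
  linarith

end Profile

/-! ### A flat space with a sequence of necks -/

section Necks

/-- The length parameters of the necks. -/
def neckLength (i : ℕ) : ℝ := 4 ^ (i + 1)

/-- The radius outside of which the `i`-th neck is flat. -/
def neckRadius (i : ℕ) : ℝ := Real.exp (neckLength i / 2)

lemma four_le_neckLength (i : ℕ) : 4 ≤ neckLength i := by
  have : (1 : ℝ) ≤ 4 ^ i := one_le_pow₀ (by norm_num)
  rw [neckLength, pow_succ]
  linarith

lemma neckLength_pos (i : ℕ) : 0 < neckLength i := by linarith [four_le_neckLength i]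

lemma neckRadius_pos (i : ℕ) : 0 < neckRadius i := Real.exp_pos _

lemma one_le_neckRadius (i : ℕ) : 1 ≤ neckRadius i :=
  Real.one_le_exp (by linarith [neckLength_pos i])

lemma four_mul_neckRadius_le (i : ℕ) : 4 * neckRadius i ≤ neckRadius (i + 1) := by
  have h1 : neckLength (i + 1) = 4 * neckLength i := by
    rw [neckLength, neckLength, pow_succ]
    ring
  have h2 : neckRadius (i + 1) = Real.exp (3 / 2 * neckLength i) * neckRadius i := by
    rw [neckRadius, neckRadius, ← Real.exp_add, h1]
    congr 1
    ring
  rw [h2]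
  have := Real.add_one_le_exp (3 / 2 * neckLength i)
  have := four_le_neckLength i
  exact mul_le_mul_of_nonneg_right (by linarith) (neckRadius_pos i).le

lemma neckRadius_mono : Monotone neckRadius :=
  monotone_nat_of_le_succ fun i => by linarith [four_mul_neckRadius_le i, neckRadius_pos i]

lemma tendsto_neckRadius : Filter.Tendsto neckRadius Filter.atTop Filter.atTop :=
  Real.tendsto_exp_atTop.comp (Filter.Tendsto.atTop_div_const two_pos
    ((tendsto_pow_atTop_atTop_of_one_lt (by norm_num : (1 : ℝ) < 4)).comp
      (Filter.tendsto_add_atTop_nat 1)))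

variable {n : ℕ}

local notation "𝔼" => EuclideanSpace ℝ (Fin n)

/-- The end of the `i`-th neck, on the ray through `e`. -/
def neckCentre (e : 𝔼) (i : ℕ) : 𝔼 := (4 * neckRadius i) • e

/-- The function `h` for which `e^{2h} |dy|²` is flat with a neck at each point `neckCentre e i`.
The supports of the summands are disjoint. -/
def neckExponent (e y : 𝔼) : ℝ :=
  -∑ᶠ i, neckProfile (neckLength i) (Real.log (‖y - neckCentre e i‖ ^ 2))

variable (n) in
/-- An open region that meets no neck other than the `i`-th one. -/
def neckRegion (i : ℕ) : Set 𝔼 :=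
  {y | ‖y‖ < 3 * neckRadius (i + 1)} ∩ ⋂ j ∈ Finset.range i, {y | 5 * neckRadius j < ‖y‖}

lemma isOpen_neckRegion (i : ℕ) : IsOpen (neckRegion n i) :=
  (isOpen_lt continuous_norm continuous_const).inter
    (isOpen_biInter_finset fun _ _ => isOpen_lt continuous_const continuous_norm)

lemma exists_mem_neckRegion (y : 𝔼) : ∃ i, y ∈ neckRegion n i := by
  classical
  have hex : ∃ i, ‖y‖ < 3 * neckRadius (i + 1) := by
    obtain ⟨i, hi⟩ := (tendsto_neckRadius.eventually_gt_atTop ‖y‖).exists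
    refine ⟨i, ?_⟩
    linarith [neckRadius_mono (Nat.le_succ i), neckRadius_pos (i + 1)]
  -- The least such index works: the radii grow by a factor of at least four.
  refine ⟨Nat.find hex, Nat.find_spec hex, ?_⟩
  simp only [Finset.mem_range, mem_iInter, mem_ofPred_eq]
  intro j hj
  have h1 := not_lt.1 (Nat.find_min hex hj)
  linarith [four_mul_neckRadius_le j, neckRadius_pos j]

lemma norm_neckCentre {e : 𝔼} (he : ‖e‖ = 1) (i : ℕ) : ‖neckCentre e i‖ = 4 * neckRadius i := by
  have := neckRadius_pos i
  rw [neckCentre, norm_smul, he, mul_one, Real.norm_of_nonneg (by positivity)]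

lemma neckCentre_injective {e : 𝔼} (he : ‖e‖ = 1) : Function.Injective (neckCentre e) := by
  have h : StrictMono neckRadius :=
    strictMono_nat_of_lt_succ fun i => by linarith [four_mul_neckRadius_le i, neckRadius_pos i]
  intro i j hij
  have h1 := congrArg norm hij
  rw [norm_neckCentre he, norm_neckCentre he] at h1
  exact h.injective (by linarith)

/-- All the necks but the `i`-th one are flat on the `i`-th region. -/
lemma neckRadius_le_dist {e : 𝔼} (he : ‖e‖ = 1) {i j : ℕ} (hij : j ≠ i) {y : 𝔼}
    (hy : y ∈ neckRegion n i) : neckRadius j ≤ ‖y - neckCentre e j‖ := by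
  have h1 := norm_neckCentre he j
  have hy1 : ‖y‖ < 3 * neckRadius (i + 1) := hy.1
  rcases lt_or_gt_of_ne hij with h | h
  · have h2 : 5 * neckRadius j < ‖y‖ := mem_iInter₂.1 hy.2 j (Finset.mem_range.2 h)
    linarith [norm_sub_norm_le y (neckCentre e j)]
  · have h2 := norm_sub_norm_le (neckCentre e j) y
    rw [norm_sub_rev] at h2
    linarith [neckRadius_mono (show i + 1 ≤ j from h)]

lemma neckProfile_of_neckRadius_le {j : ℕ} {d : ℝ} (h : neckRadius j ≤ d) :
    neckProfile (neckLength j) (Real.log (d ^ 2)) = 0 := by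
  refine neckProfile_of_le (neckLength_pos j) ?_
  rw [Real.log_pow, Nat.cast_ofNat]
  linarith [(Real.le_log_iff_exp_le ((neckRadius_pos j).trans_le h)).2 h]

lemma neckExponent_eq {e : 𝔼} (he : ‖e‖ = 1) {i : ℕ} {y : 𝔼} (hy : y ∈ neckRegion n i) :
    neckExponent e y = -neckProfile (neckLength i) (Real.log (‖y - neckCentre e i‖ ^ 2)) := by
  rw [neckExponent, finsum_eq_single _ i]
  exact fun j hj => neckProfile_of_neckRadius_le (neckRadius_le_dist he hj hy)

lemma neckExponent_nonneg {e : 𝔼} (he : ‖e‖ = 1) (y : 𝔼) : 0 ≤ neckExponent e y := by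
  obtain ⟨i, hi⟩ := exists_mem_neckRegion y
  rw [neckExponent_eq he hi]
  exact neg_nonneg.2 (neckProfile_nonpos (neckLength_pos i) _)

/-- The metric `e^{2h} |dy|²` blows up at least like `|y - z|⁻² |dy|²` at the end `z` of a neck. -/
lemma neg_log_dist_le_neckExponent {e : 𝔼} (he : ‖e‖ = 1) (i : ℕ) (y : 𝔼) :
    -Real.log ‖y - neckCentre e i‖ ≤ neckExponent e y := by
  obtain ⟨j, hj⟩ := exists_mem_neckRegion y
  rcases eq_or_ne i j with rfl | hij
  · rw [neckExponent_eq he hj]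
    have := two_mul_neckProfile_le (neckLength_pos i) (Real.log (‖y - neckCentre e i‖ ^ 2))
    rw [Real.log_pow, Nat.cast_ofNat] at this ⊢
    linarith
  · have h1 := neckRadius_le_dist he hij hj
    linarith [neckExponent_nonneg he y, Real.log_nonneg ((one_le_neckRadius i).trans h1)]

lemma eventuallyEq_neckExponent {e : 𝔼} (he : ‖e‖ = 1) {i : ℕ} {y : 𝔼}
    (hy : y ∈ neckRegion n i) : neckExponent e =ᶠ[𝓝 y]
      fun z => -neckProfile (neckLength i) (Real.log (‖z - neckCentre e i‖ ^ 2)) := by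
  filter_upwards [(isOpen_neckRegion i).mem_nhds hy] with z hz
  exact neckExponent_eq he hz

lemma contDiffAt_neckExponent {e : 𝔼} (he : ‖e‖ = 1) {y : 𝔼} (hy : ∀ i, y ≠ neckCentre e i) :
    ContDiffAt ℝ ∞ (neckExponent e) y := by
  obtain ⟨i, hi⟩ := exists_mem_neckRegion y
  refine ContDiffAt.congr_of_eventuallyEq ?_ (eventuallyEq_neckExponent he hi)
  have h1 : ContDiffAt ℝ ∞ (fun z : 𝔼 => ‖z - neckCentre e i‖ ^ 2) y :=
    ((contDiff_norm_sq ℝ).comp (contDiff_id.sub contDiff_const)).contDiffAt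
  have h2 := norm_pos_iff.2 (sub_ne_zero.2 (hy i))
  exact ((contDiff_neckProfile _).contDiffAt.comp y (h1.log (by positivity))).neg

/-- The exponent `h` has gradient at most `2` for the metric `e^{2h} |dy|²`. -/
lemma abs_fderiv_neckExponent_le {e : 𝔼} (he : ‖e‖ = 1) {y : 𝔼} (hy : ∀ i, y ≠ neckCentre e i)
    (u : 𝔼) : |fderiv ℝ (neckExponent e) y u| ≤ 2 * (Real.exp (neckExponent e y) * ‖u‖) := by
  obtain ⟨i, hi⟩ := exists_mem_neckRegion y
  set z := neckCentre e i
  have hd : 0 < ‖y - z‖ := norm_pos_iff.2 (sub_ne_zero.2 (hy i))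
  have h0 : HasFDerivAt (fun x : 𝔼 => ‖x - z‖ ^ 2) (2 • innerSL ℝ (y - z)) y := by
    exact ((hasStrictFDerivAt_norm_sq (y - z)).hasFDerivAt.comp y
      ((hasFDerivAt_id y).sub_const z)).congr_fderiv (ContinuousLinearMap.comp_id _)
  have h1 := ((hasDerivAt_neckProfile (neckLength_pos i) _).comp_hasFDerivAt y
    (h0.log (by positivity))).neg
  have h2 : Real.exp (neckExponent e y) * ‖y - z‖ ≥ 1 := by
    have := Real.exp_le_exp.2 (neg_log_dist_le_neckExponent he i y)
    rw [Real.exp_neg, Real.exp_log hd] at this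
    exact (inv_le_iff_one_le_mul₀ hd).1 this
  rw [(h1.congr_of_eventuallyEq (eventuallyEq_neckExponent he hi)).fderiv]
  simp only [neg_apply, smul_apply, innerSL_apply_apply, smul_eq_mul, abs_neg, abs_mul, nsmul_eq_mul,
    Nat.cast_ofNat, abs_two, abs_inv, abs_pow, abs_norm]
  set s := neckSlope (neckLength i) (Real.log (‖y - z‖ ^ 2))
  have hs : |s| ≤ 1 := by
    rw [abs_of_nonneg (neckSlope_nonneg _ _)]
    exact neckSlope_le_one _ _
  calc |s| * ((‖y - z‖ ^ 2)⁻¹ * (2 * |inner ℝ (y - z) u|))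
      ≤ 1 * ((‖y - z‖ ^ 2)⁻¹ * (2 * (‖y - z‖ * ‖u‖))) := by
        gcongr
        exact abs_real_inner_le_norm _ _
    _ = 2 * (1 * ‖u‖) / ‖y - z‖ := by
        have := hd.ne'
        field_simp
    _ ≤ 2 * (Real.exp (neckExponent e y) * ‖y - z‖ * ‖u‖) / ‖y - z‖ := by gcongr
    _ = _ := by
        have := hd.ne'
        field_simp

/-- A proper function for the metric `e^{2h} |dy|²`, on the complement of the ends of the necks. -/
def neckExhaustion (e y : 𝔼) : ℝ := neckExponent e y + Real.log (1 + ‖y‖ ^ 2)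

lemma contDiffAt_neckExhaustion {e : 𝔼} (he : ‖e‖ = 1) {y : 𝔼} (hy : ∀ i, y ≠ neckCentre e i) :
    ContDiffAt ℝ ∞ (neckExhaustion e) y :=
  (contDiffAt_neckExponent he hy).add
    ((contDiff_const.add (contDiff_norm_sq ℝ)).contDiffAt.log (by positivity))

lemma abs_fderiv_neckExhaustion_le {e : 𝔼} (he : ‖e‖ = 1) {y : 𝔼}
    (hy : ∀ i, y ≠ neckCentre e i) (u : 𝔼) :
    |fderiv ℝ (neckExhaustion e) y u| ≤ 3 * (Real.exp (neckExponent e y) * ‖u‖) := by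
  have h0 : HasFDerivAt (fun x : 𝔼 => ‖x‖ ^ 2) (2 • innerSL ℝ y) y :=
    (hasStrictFDerivAt_norm_sq y).hasFDerivAt
  have h1 := (h0.const_add 1).log (by positivity)
  have h2 := ((contDiffAt_neckExponent he hy).differentiableAt (by simp)).hasFDerivAt.add h1
  have h3 : HasFDerivAt (neckExhaustion e) _ y := h2
  rw [h3.fderiv, add_apply]
  refine (abs_add_le _ _).trans ?_
  have h4 := abs_fderiv_neckExponent_le he hy u
  have h5 : |((1 + ‖y‖ ^ 2)⁻¹ • (2 • innerSL ℝ y)) u| ≤ ‖u‖ := by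
    simp only [smul_apply, innerSL_apply_apply, smul_eq_mul, abs_mul, nsmul_eq_mul,
      Nat.cast_ofNat, abs_two]
    rw [abs_of_pos (by positivity), inv_mul_le_iff₀ (by positivity)]
    have h6 := abs_real_inner_le_norm y u
    nlinarith [norm_nonneg u, sq_nonneg (‖y‖ - 1), mul_nonneg (sq_nonneg (‖y‖ - 1)) (norm_nonneg u)]
  have h6 : ‖u‖ ≤ Real.exp (neckExponent e y) * ‖u‖ :=
    le_mul_of_one_le_left (norm_nonneg u) (Real.one_le_exp (neckExponent_nonneg he y))
  linarith

/-- The sublevel sets of `neckExhaustion e` are contained in compact subsets of the complement of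
the ends of the necks. -/
lemma exists_isCompact_neckExhaustion {e : 𝔼} (he : ‖e‖ = 1) (c : ℝ) :
    ∃ K : Set 𝔼, IsCompact K ∧ (∀ y ∈ K, ∀ i, y ≠ neckCentre e i) ∧
      ∀ y, (∀ i, y ≠ neckCentre e i) → neckExhaustion e y ≤ c → y ∈ K := by
  refine ⟨closedBall 0 (Real.exp c) ∩ ⋂ i, {y | Real.exp (-c) ≤ ‖y - neckCentre e i‖},
    (isCompact_closedBall _ _).inter_right (isClosed_iInter fun i =>
      isClosed_le continuous_const (continuous_id.sub continuous_const).norm), ?_, ?_⟩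
  · rintro y ⟨-, hy⟩ i rfl
    have := mem_iInter.1 hy i
    simp only [sub_self, norm_zero, mem_ofPred_eq] at this
    exact absurd this (not_le.2 (Real.exp_pos _))
  · intro y hy hc
    have h1 := neckExponent_nonneg he y
    have h2 : (0 : ℝ) < 1 + ‖y‖ ^ 2 := by positivity
    have h3 : 0 ≤ Real.log (1 + ‖y‖ ^ 2) := Real.log_nonneg (by linarith [sq_nonneg ‖y‖])
    rw [neckExhaustion] at hc
    refine ⟨?_, mem_iInter.2 fun i => ?_⟩
    · rw [mem_closedBall_zero_iff]
      have := (Real.log_le_iff_le_exp h2).1 (show Real.log (1 + ‖y‖ ^ 2) ≤ c by linarith)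
      nlinarith [sq_nonneg (‖y‖ - 1)]
    · have h4 := neg_log_dist_le_neckExponent he i y
      exact (Real.le_log_iff_exp_le (norm_pos_iff.2 (sub_ne_zero.2 (hy i)))).1 (by linarith)

end Necks

/-! ### The domain of the sphere -/

section Domain

variable {n : ℕ}

local notation "𝔼" => EuclideanSpace ℝ (Fin n)
local notation "𝔽" => EuclideanSpace ℝ (Fin (n + 1))

/-- The inverse of the stereographic projection with pole `v`, with values in the sphere. -/
def stereoPoint (v : UnitSphere n) (y : 𝔼) : UnitSphere n :=
  haveI := Fact.mk (@finrank_euclideanSpace_fin ℝ _ (n + 1))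
  (stereographic' n v).symm y

lemma coe_stereoPoint (v : UnitSphere n) (y : 𝔼) : (stereoPoint v y : 𝔽) = invStereo v y :=
  invStereo_eq v y

lemma continuous_stereoPoint (v : UnitSphere n) : Continuous (stereoPoint v) := by
  have := Fact.mk (@finrank_euclideanSpace_fin ℝ _ (n + 1))
  have h := (stereographic' n v).continuousOn_symm
  rw [stereographic'_target] at h
  exact continuousOn_univ.1 h

lemma stereoPoint_injective (v : UnitSphere n) : Function.Injective (stereoPoint v) := by
  have := Fact.mk (@finrank_euclideanSpace_fin ℝ _ (n + 1))
  have h := (stereographic' n v).symm.injOn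
  rw [OpenPartialHomeomorph.symm_source, stereographic'_target] at h
  exact injOn_univ.1 h

lemma range_stereoPoint (v : UnitSphere n) : range (stereoPoint v) = {v}ᶜ := by
  have := Fact.mk (@finrank_euclideanSpace_fin ℝ _ (n + 1))
  have h := (stereographic' n v).symm.image_source_eq_target
  rwa [OpenPartialHomeomorph.symm_source, OpenPartialHomeomorph.symm_target,
    stereographic'_target, stereographic'_source, image_univ] at h

lemma stereoPoint_zero (v : UnitSphere n) : stereoPoint v 0 = -v := by
  refine Subtype.ext ?_
  rw [coe_stereoPoint, invStereo]
  simp [smul_smul]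

/-- Points that go to infinity in the stereographic projection converge to the pole. -/
lemma tendsto_stereoPoint (v : UnitSphere n) {z : ℕ → 𝔼}
    (hz : Filter.Tendsto (fun i => ‖z i‖) Filter.atTop Filter.atTop) :
    Filter.Tendsto (fun i => stereoPoint v (z i)) Filter.atTop (𝓝 v) := by
  rw [tendsto_subtype_rng, tendsto_iff_norm_sub_tendsto_zero]
  have h : ∀ y, ‖(stereoPoint v y : 𝔽) - v‖ = Real.sqrt (16 / (‖y‖ ^ 2 + 4)) := by
    intro y
    rw [eq_comm, Real.sqrt_eq_iff_mul_self_eq (by positivity) (norm_nonneg _), ← pow_two,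
      norm_sub_sq_real, norm_eq_of_mem_sphere, norm_eq_of_mem_sphere, coe_stereoPoint,
      inner_invStereo_pole]
    field_simp
    ring
  simp only [h]
  rw [← Real.sqrt_zero]
  refine (Real.continuous_sqrt.tendsto 0).comp ?_
  refine Filter.Tendsto.const_div_atTop ?_ _
  exact Filter.tendsto_atTop_add_const_right _ _ ((Filter.tendsto_pow_atTop two_ne_zero).comp hz)

/-- The closed set that is removed from the sphere: the pole `-q` and a sequence of points that
converges to it. -/
def neckEnds (q : UnitSphere n) {e : 𝔼} (he : ‖e‖ = 1) : TopologicalSpace.Closeds (UnitSphere n) :=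
  ⟨insert (-q) (range fun i => stereoPoint (-q) (neckCentre e i)), by
    refine (tendsto_stereoPoint (-q) ?_).isCompact_insert_range.isClosed
    simp only [norm_neckCentre he]
    exact tendsto_neckRadius.const_mul_atTop four_pos⟩

lemma coe_neckEnds (q : UnitSphere n) {e : 𝔼} (he : ‖e‖ = 1) :
    (neckEnds q he : Set (UnitSphere n))
      = insert (-q) (range fun i => stereoPoint (-q) (neckCentre e i)) := rfl

lemma stereoPoint_mem_neckEnds (q : UnitSphere n) {e : 𝔼} (he : ‖e‖ = 1) (y : 𝔼) :
    stereoPoint (-q) y ∈ (neckEnds q he : Set (UnitSphere n)) ↔ ∃ i, y = neckCentre e i := by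
  have h : stereoPoint (-q) y ≠ -q := by
    have : stereoPoint (-q) y ∈ range (stereoPoint (-q)) := mem_range_self y
    rwa [range_stereoPoint] at this
  rw [coe_neckEnds, mem_insert_iff, or_iff_right h]
  constructor
  · rintro ⟨i, hi⟩
    exact ⟨i, (stereoPoint_injective _ hi).symm⟩
  · rintro ⟨i, rfl⟩
    exact ⟨i, rfl⟩

lemma compl_neckEnds (q : UnitSphere n) {e : 𝔼} (he : ‖e‖ = 1) :
    (neckEnds q he : Set (UnitSphere n))ᶜ = stereoPoint (-q) '' (range (neckCentre e))ᶜ := by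
  rw [image_compl_eq_range_sdiff_image (stereoPoint_injective _), range_stereoPoint, coe_neckEnds,
    ← range_comp]
  ext x
  simp

lemma infinite_neckEnds (q : UnitSphere n) {e : 𝔼} (he : ‖e‖ = 1) :
    (neckEnds q he : Set (UnitSphere n)).Infinite :=
  (infinite_range_of_injective
    ((stereoPoint_injective (-q)).comp (neckCentre_injective he))).mono (subset_insert _ _)

/-- In the stereographic projection, the domain is the complement of a countable set. -/
lemma isConnected_compl_neckEnds (hn : 3 ≤ n) (q : UnitSphere n) {e : 𝔼} (he : ‖e‖ = 1) :
    IsConnected (neckEnds q he : Set (UnitSphere n))ᶜ := by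
  rw [compl_neckEnds]
  refine IsConnected.image ?_ _ (continuous_stereoPoint _).continuousOn
  refine (Countable.isPathConnected_compl_of_one_lt_rank ?_ (countable_range _)).isConnected
  rw [← Module.finrank_eq_rank, finrank_euclideanSpace_fin]
  exact_mod_cast (by lia : 1 < n)

lemma base_mem_compl (q : UnitSphere n) {e : 𝔼} (he : ‖e‖ = 1) :
    q ∈ (neckEnds q he).compl := by
  have h := stereoPoint_mem_neckEnds q he 0
  rw [stereoPoint_zero, neg_neg] at h
  refine fun hq => ?_
  obtain ⟨i, hi⟩ := h.1 hq
  have h1 := norm_neckCentre he i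
  rw [← hi, norm_zero] at h1
  linarith [neckRadius_pos i]

/-- The base point, as a point of the domain. -/
def basePoint (q : UnitSphere n) {e : 𝔼} (he : ‖e‖ = 1) : (neckEnds q he).compl :=
  ⟨q, base_mem_compl q he⟩

/-- The chart at the base point covers the domain. -/
lemma base_source_eq (q : UnitSphere n) {e : 𝔼} (he : ‖e‖ = 1) : (extChartAt (𝓡 n) (basePoint q he)).source = univ := by
  rw [extChartAt_source_eq, eq_univ_iff_forall]
  rintro z hz
  exact z.2 (Or.inl hz)

lemma mem_base_target (q : UnitSphere n) {e : 𝔼} (he : ‖e‖ = 1) {y : 𝔼} :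
    y ∈ (extChartAt (𝓡 n) (basePoint q he)).target ↔ ∀ i, y ≠ neckCentre e i := by
  have := Fact.mk (@finrank_euclideanSpace_fin ℝ _ (n + 1))
  have h1 : y ∈ (extChartAt (𝓡 n) (basePoint q he)).target
      ↔ stereoPoint (-q) y ∈ ((neckEnds q he).compl : Set (UnitSphere n)) := by
    have h2 : (chartAt 𝔼 q).target = univ := stereographic'_target (-q)
    have h3 : (extChartAt (𝓡 n) (basePoint q he)).target
      = ((chartAt 𝔼 q).subtypeRestr ⟨basePoint q he⟩).target := by
      simp [extChartAt, TopologicalSpace.Opens.chartAt_eq, basePoint]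
    rw [h3, OpenPartialHomeomorph.subtypeRestr_def, OpenPartialHomeomorph.trans_target, h2,
      univ_inter]
    simp
    rfl
  rw [h1]
  refine (not_congr (stereoPoint_mem_neckEnds q he y)).trans ?_
  exact not_exists

end Domain

/-! ### The metric with necks and its sectional curvatures -/

section NeckMetric

variable {n : ℕ}

local notation "𝔼" => EuclideanSpace ℝ (Fin n)
local notation "𝔽" => EuclideanSpace ℝ (Fin (n + 1))

lemma one_sub_inner_invStereo_pole (v : UnitSphere n) (y : 𝔼) :
    (1 - inner ℝ (invStereo v y) (v : 𝔽)) / 2 = 4 / (‖y‖ ^ 2 + 4) := by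
  rw [inner_invStereo_pole]
  field_simp
  ring

lemma one_sub_inner_pole_invStereo (v : UnitSphere n) (y : 𝔼) :
    1 - inner ℝ (v : 𝔽) (invStereo v y) = 8 / (‖y‖ ^ 2 + 4) := by
  have := one_sub_inner_invStereo_pole v y
  rw [real_inner_comm]
  have h : (8 : ℝ) / (‖y‖ ^ 2 + 4) = 2 * (4 / (‖y‖ ^ 2 + 4)) := by ring
  linarith

lemma one_sub_inner_invStereo_invStereo (v : UnitSphere n) (y z : 𝔼) :
    (‖z‖ ^ 2 + 4) / 2 * (1 - inner ℝ (invStereo v y) (invStereo v z))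
      = ‖y - z‖ ^ 2 * (4 / (‖y‖ ^ 2 + 4)) := by
  have h1 : inner ℝ (poleIsometry v y) (invStereo v z)
      = (‖z‖ ^ 2 + 4)⁻¹ * (4 * inner ℝ y z) := by
    rw [real_inner_comm, inner_invStereo_poleIsometry, real_inner_comm]
  have h2 : inner ℝ (v : 𝔽) (invStereo v z) = (‖z‖ ^ 2 + 4)⁻¹ * (‖z‖ ^ 2 - 4) := by
    rw [real_inner_comm, inner_invStereo_pole]
  rw [invStereo, real_inner_smul_left, inner_add_left, real_inner_smul_left, real_inner_smul_left,
    h1, h2, norm_sub_sq_real]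
  field_simp
  ring

/-- The logarithm of the conformal factor. In the stereographic chart centred at `q`, the metric
`e^{2f} can` is `e^{2h} |dy|²` with `h = neckExponent e`. -/
def neckFactor (q : UnitSphere n) {e : 𝔼} (he : ‖e‖ = 1) (x : (neckEnds q he).compl) : ℝ :=
  neckExponent e (extChartAt (𝓡 n) (basePoint q he) x)
    - Real.log (4 / (‖extChartAt (𝓡 n) (basePoint q he) x‖ ^ 2 + 4))

lemma extChartAt_base_mem_target (q : UnitSphere n) {e : 𝔼} (he : ‖e‖ = 1)
    (x : (neckEnds q he).compl) : extChartAt (𝓡 n) (basePoint q he) x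
      ∈ (extChartAt (𝓡 n) (basePoint q he)).target :=
  (extChartAt (𝓡 n) (basePoint q he)).map_source (base_source_eq q he ▸ mem_univ _)

lemma extChartAt_base_ne (q : UnitSphere n) {e : 𝔼} (he : ‖e‖ = 1)
    (x : (neckEnds q he).compl) (i : ℕ) :
    extChartAt (𝓡 n) (basePoint q he) x ≠ neckCentre e i :=
  (mem_base_target q he).1 (extChartAt_base_mem_target q he x) i

lemma contMDiff_extChartAt_base (q : UnitSphere n) {e : 𝔼} (he : ‖e‖ = 1) :
    ContMDiff (𝓡 n) 𝓘(ℝ, 𝔼) ∞ (extChartAt (𝓡 n) (basePoint q he)) := by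
  have h : (chartAt 𝔼 (basePoint q he)).source = univ := by
    rw [← extChartAt_source (𝓡 n), base_source_eq]
  rw [← contMDiffOn_univ, ← h]
  exact contMDiffOn_extChartAt

lemma contMDiff_neckFactor (q : UnitSphere n) {e : 𝔼} (he : ‖e‖ = 1) :
    ContMDiff (𝓡 n) 𝓘(ℝ, ℝ) ∞ (neckFactor q he) := by
  intro x
  have h1 : ContDiffAt ℝ ∞ (fun y : 𝔼 => neckExponent e y - Real.log (4 / (‖y‖ ^ 2 + 4)))
      (extChartAt (𝓡 n) (basePoint q he) x) := by
    refine (contDiffAt_neckExponent he (extChartAt_base_ne q he x)).sub (ContDiffAt.log ?_ ?_)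
    · exact (contDiff_const.div ((contDiff_norm_sq ℝ).add contDiff_const)
        fun x => by positivity).contDiffAt
    · positivity
  exact h1.contMDiffAt.comp x (contMDiff_extChartAt_base q he x)

/-- The metric with necks. -/
def neckMetric (q : UnitSphere n) {e : 𝔼} (he : ‖e‖ = 1) : SmoothMetric n (neckEnds q he).compl :=
  conformalMetric (neckFactor q he) (contMDiff_neckFactor q he)

lemma neckMetric_inner (q : UnitSphere n) {e : 𝔼} (he : ‖e‖ = 1) (x : (neckEnds q he).compl)
    (u v : TangentSpace (𝓡 n) x) : (neckMetric q he).inner x u v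
      = Real.exp (2 * neckFactor q he x) * roundMetric (neckEnds q he).compl x u v :=
  conformalMetric_inner _ _ x u v

lemma chartExponent_base (q : UnitSphere n) {e : 𝔼} (he : ‖e‖ = 1) {y : 𝔼}
    (hy : y ∈ (extChartAt (𝓡 n) (basePoint q he)).target) :
    chartExponent (neckFactor q he) (basePoint q he) y = neckExponent e y := by
  rw [chartExponent, neckFactor, (extChartAt (𝓡 n) (basePoint q he)).right_inv hy]
  ring

/-- In the chart at the base point the metric is `e^{2h} |dy|²`. -/
lemma neckMetric_inner_self (q : UnitSphere n) {e : 𝔼} (he : ‖e‖ = 1) (x : (neckEnds q he).compl)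
    (u : TangentSpace (𝓡 n) x) : (neckMetric q he).inner x u u
      = (Real.exp (neckExponent e (extChartAt (𝓡 n) (basePoint q he) x)) *
        @norm 𝔼 _ (mfderiv (𝓡 n) 𝓘(ℝ, 𝔼) (extChartAt (𝓡 n) (basePoint q he)) x u)) ^ 2 := by
  have hx : x ∈ (chartAt 𝔼 (basePoint q he)).source := by
    rw [← extChartAt_source (𝓡 n), base_source_eq]
    exact mem_univ x
  rw [neckMetric_inner, roundMetric_eq_chart _ hx]
  refine (congrArg (fun t => _ * (_ * t)) (real_inner_self_eq_norm_sq _)).trans ?_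
  set y := extChartAt (𝓡 n) (basePoint q he) x with hy
  have h1 : Real.exp (2 * neckFactor q he x)
      = (Real.exp (neckExponent e y) / (4 / (‖y‖ ^ 2 + 4))) ^ 2 := by
    rw [neckFactor, ← hy, two_mul, Real.exp_add, Real.exp_sub, Real.exp_log (by positivity)]
    ring
  rw [h1]
  field_simp

lemma isCompleteMetric_neckMetric (q : UnitSphere n) {e : 𝔼} (he : ‖e‖ = 1) :
    IsCompleteMetric (neckMetric q he) := by
  set Y := extChartAt (𝓡 n) (basePoint q he) with hY
  have hsm : ContMDiff (𝓡 n) 𝓘(ℝ, ℝ) ∞ (neckExhaustion e ∘ Y) := fun x =>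
    (contDiffAt_neckExhaustion he (extChartAt_base_ne q he x)).contMDiffAt.comp x
      (contMDiff_extChartAt_base q he x)
  refine isCompleteMetric_of_proper (neckMetric q he) (f := neckExhaustion e ∘ Y) (C := 3)
    (hsm.of_le (by simp)) ?_ ?_
  · intro c
    obtain ⟨K, hK, hKt, hcK⟩ := exists_isCompact_neckExhaustion he c
    refine (hK.image_of_continuousOn ((continuousOn_extChartAt_symm (basePoint q he)).mono
      fun y hy => (mem_base_target q he).2 (hKt y hy))).of_isClosed_subset
      (isClosed_le hsm.continuous continuous_const) ?_
    intro x hx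
    exact ⟨Y x, hcK _ (extChartAt_base_ne q he x) hx,
      Y.left_inv (base_source_eq q he ▸ mem_univ x)⟩
  · intro x u
    have h1 := mfderiv_comp x (I' := 𝓘(ℝ, 𝔼))
      ((contDiffAt_neckExhaustion he (extChartAt_base_ne q he x)).differentiableAt
        (by simp)).mdifferentiableAt
      ((contMDiff_extChartAt_base q he).mdifferentiableAt (by simp) (x := x))
    rw [mfderiv_eq_fderiv] at h1
    have h2 : mfderiv (𝓡 n) 𝓘(ℝ, ℝ) (neckExhaustion e ∘ Y) x u
      = fderiv ℝ (neckExhaustion e) (Y x) (mfderiv (𝓡 n) 𝓘(ℝ, 𝔼) Y x u) :=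
      congrArg (fun L : 𝔼 →L[ℝ] ℝ => L u) h1
    have h3 : Real.sqrt ((neckMetric q he).inner x u u) = Real.exp (neckExponent e (Y x)) *
        @norm 𝔼 _ (mfderiv (𝓡 n) 𝓘(ℝ, 𝔼) Y x u) :=
      (congrArg Real.sqrt (neckMetric_inner_self q he x u)).trans
        (Real.sqrt_sq (mul_nonneg (Real.exp_pos _).le (@norm_nonneg 𝔼 _ _)))
    refine (congrArg (fun t : ℝ => |t|) h2).trans_le ?_
    refine (abs_fderiv_neckExhaustion_le he (extChartAt_base_ne q he x) _).trans_eq ?_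
    exact congrArg (fun t : ℝ => 3 * t) h3.symm

end NeckMetric

section NeckCurvature

variable {n : ℕ}

local notation "𝔼" => EuclideanSpace ℝ (Fin n)
local notation "𝔽" => EuclideanSpace ℝ (Fin (n + 1))

lemma smul_isotropicQuadratic (c α γ : ℝ) (β y : 𝔼) :
    isotropicQuadratic (c * α) (c • β) (c * γ) y = c * isotropicQuadratic α β γ y := by
  rw [isotropicQuadratic, isotropicQuadratic, real_inner_smul_left]
  ring

lemma ambient_eq_invStereo_base (q : UnitSphere n) {e : 𝔼} (he : ‖e‖ = 1)
    (x : (neckEnds q he).compl) :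
    ambient x = invStereo (-q) (extChartAt (𝓡 n) (basePoint q he) x) := by
  refine Eq.trans ?_ (ambient_extChartAt_symm (basePoint q he) (extChartAt_base_mem_target q he x))
  rw [(extChartAt (𝓡 n) (basePoint q he)).left_inv (base_source_eq q he ▸ mem_univ x)]

/-- The function `c (1 - ⟨·, a⟩)` in the chart with pole `v`, up to the conformal factor of the
chart. -/
def affineQuadratic (v : UnitSphere n) (c : ℝ) (a : 𝔽) (y : 𝔼) : ℝ :=
  isotropicQuadratic (c * (1 + inner ℝ (v : 𝔽) a)) (c • -poleCoord v a)
    (c * ((1 - inner ℝ (v : 𝔽) a) / 4)) y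

lemma affineQuadratic_eq (v : UnitSphere n) (c : ℝ) (a : 𝔽) (y : 𝔼) :
    affineQuadratic v c a y = c * (1 - inner ℝ (invStereo v y) a) * ((‖y‖ ^ 2 + 4) / 4) := by
  rw [affineQuadratic, smul_isotropicQuadratic, ← one_sub_inner_invStereo, mul_assoc]

lemma affineQuadratic_null (v : UnitSphere n) (c : ℝ) {a : 𝔽} (ha : inner ℝ a a = 1) :
    inner ℝ (c • -poleCoord v a) (c • -poleCoord v a)
      = 4 * (c * (1 + inner ℝ (v : 𝔽) a)) * (c * ((1 - inner ℝ (v : 𝔽) a) / 4)) := by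
  rw [real_inner_smul_left, real_inner_smul_right, inner_neg_neg, inner_poleCoord, ha]
  ring

/-- The null quadratic polynomials of two points of the sphere pair to a multiple of the squared
distance of the points. -/
lemma affineQuadratic_polar (v : UnitSphere n) (c d : ℝ) (a b : 𝔽) :
    2 * (c * (1 + inner ℝ (v : 𝔽) a)) * (d * ((1 - inner ℝ (v : 𝔽) b) / 4))
      + 2 * (d * (1 + inner ℝ (v : 𝔽) b)) * (c * ((1 - inner ℝ (v : 𝔽) a) / 4))
      - inner ℝ (c • -poleCoord v a) (d • -poleCoord v b) = c * d * (1 - inner ℝ a b) := by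
  rw [real_inner_smul_left, real_inner_smul_right, inner_neg_neg, inner_poleCoord]
  ring

/-- Near a point whose planar coordinates lie in the `i`-th region, the sectional curvatures are
controlled by the bending of the profile of the `i`-th neck. -/
lemma le_of_mem_sectionalCurvaturesAt (q : UnitSphere n) {e : 𝔼} (he : ‖e‖ = 1)
    (p : (neckEnds q he).compl) {i : ℕ} {y : 𝔼} (hy : extChartAt (𝓡 n) (basePoint q he) p = y)
    (hi : y ∈ neckRegion n i) {κ : ℝ} (hκ : κ ∈ sectionalCurvaturesAt (neckMetric q he) p) :
    -(Real.exp (-(2 * neckExponent e y)) *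
      (4 * |neckBend (neckLength i) (Real.log (‖y - neckCentre e i‖ ^ 2))|
        / ‖y - neckCentre e i‖ ^ 2)) ≤ κ := by
  set Y := extChartAt (𝓡 n) (basePoint q he) with hY
  set z := neckCentre e i with hz
  set v : UnitSphere n := -(p : UnitSphere n) with hv
  set P : 𝔽 := invStereo (-q) z with hP
  set c : ℝ := (‖z‖ ^ 2 + 4) / 2 with hc
  obtain ⟨u, w, huw, rfl⟩ := hκ
  have hPP : inner ℝ P P = 1 := by
    rw [hP, ← coe_stereoPoint]
    exact inner_self_unitSphere _
  have hpt : ∀ x : (neckEnds q he).compl, 0 < ‖Y x - z‖ ^ 2 := fun x =>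
    pow_pos (norm_pos_iff.2 (sub_ne_zero.2 (extChartAt_base_ne q he x i))) 2
  -- The two quadratic polynomials, in terms of the planar coordinates.
  have hA : ∀ t ∈ (extChartAt (𝓡 n) p).target,
      affineQuadratic v (1 / 2) ((-q : UnitSphere n) : 𝔽) t
      = 4 / (‖Y ((extChartAt (𝓡 n) p).symm t)‖ ^ 2 + 4) * ((‖t‖ ^ 2 + 4) / 4) := by
    intro t ht
    rw [affineQuadratic_eq, hv, ← ambient_extChartAt_symm p ht, ambient_eq_invStereo_base,
      ← one_sub_inner_invStereo_pole (-q)]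
    ring
  have hB : ∀ t ∈ (extChartAt (𝓡 n) p).target, affineQuadratic v c P t
      = ‖Y ((extChartAt (𝓡 n) p).symm t) - z‖ ^ 2 *
        affineQuadratic v (1 / 2) ((-q : UnitSphere n) : 𝔽) t := by
    intro t ht
    rw [hA t ht, affineQuadratic_eq, hv, ← ambient_extChartAt_symm p ht, ambient_eq_invStereo_base,
      hP, one_sub_inner_invStereo_invStereo]
    ring
  have hA0 : ∀ t ∈ (extChartAt (𝓡 n) p).target,
      0 < affineQuadratic v (1 / 2) ((-q : UnitSphere n) : 𝔽) t := by
    intro t ht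
    rw [hA t ht]
    positivity
  have hB0 : ∀ t ∈ (extChartAt (𝓡 n) p).target, 0 < affineQuadratic v c P t := by
    intro t ht
    rw [hB t ht]
    exact mul_pos (hpt _) (hA0 t ht)
  have hlog : ∀ t ∈ (extChartAt (𝓡 n) p).target, Real.log (affineQuadratic v c P t)
      - Real.log (affineQuadratic v (1 / 2) ((-q : UnitSphere n) : 𝔽) t)
      = Real.log (‖Y ((extChartAt (𝓡 n) p).symm t) - z‖ ^ 2) := by
    intro t ht
    rw [hB t ht, Real.log_mul (hpt _).ne' (hA0 t ht).ne']
    ring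
  have hw : ∀ t ∈ (extChartAt (𝓡 n) p).target, chartExponent (neckFactor q he) p t
      = neckExponent e (Y ((extChartAt (𝓡 n) p).symm t))
        - Real.log (affineQuadratic v (1 / 2) ((-q : UnitSphere n) : 𝔽) t) := by
    intro t ht
    rw [hA t ht, chartExponent, neckFactor, ← hY, Real.log_mul (by positivity) (by positivity),
      ← inv_div 4 (‖t‖ ^ 2 + 4), Real.log_inv]
    ring
  have h0 : (0 : 𝔼) ∈ (extChartAt (𝓡 n) p).target := by
    rw [← extChartAt_self p]
    exact mem_extChartAt_target p
  have hp0 : (extChartAt (𝓡 n) p).symm 0 = p := by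
    rw [← extChartAt_self p]
    exact extChartAt_to_inv p
  have htarget : ∀ᶠ t in 𝓝 (0 : 𝔼), t ∈ (extChartAt (𝓡 n) p).target :=
    (isOpen_extChartAt_target p).mem_nhds h0
  have hcont : ContinuousAt (fun t => Y ((extChartAt (𝓡 n) p).symm t)) 0 :=
    (contMDiff_extChartAt_base q he).continuous.continuousAt.comp
      ((continuousOn_extChartAt_symm p).continuousAt ((isOpen_extChartAt_target p).mem_nhds h0))
  have hregion : ∀ᶠ t in 𝓝 (0 : 𝔼), Y ((extChartAt (𝓡 n) p).symm t) ∈ neckRegion n i := by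
    refine hcont.eventually_mem ((isOpen_neckRegion i).mem_nhds ?_)
    rw [hp0, hy]
    exact hi
  have huw' : LinearIndependent ℝ ![(u : 𝔼), w] := huw
  have key := le_coordSectionalCurvature_of_profile (G := metricInChart (neckMetric q he) p)
    (w := chartExponent (neckFactor q he) p) (hasDerivAt_neckProfile (neckLength_pos i))
    (hasDerivAt_neckSlope (neckLength i)) (neckSlope_nonneg _) (neckSlope_le_one _)
    (hA0 0 h0) (hB0 0 h0) (affineQuadratic_null v (1 / 2) (inner_self_unitSphere _))
    (affineQuadratic_null v c hPP)
    (htarget.mono fun t ht => metricInChart_eq (neckMetric_inner q he) p ht)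
    (by
      filter_upwards [htarget, hregion] with t ht hr
      refine (hw t ht).trans ?_
      rw [neckExponent_eq he hr, ← hlog t ht]
      simp only [affineQuadratic]
      ring) huw'
  rw [affineQuadratic_polar] at key
  change _ ≤ coordSectionalCurvature _ _ _ _ at key
  rw [sectionalCurvature, tangentCoord_eq, tangentCoord_eq, extChartAt_self]
  refine le_trans (le_of_eq ?_) key
  have hd : ‖y - z‖ ^ 2 ≠ 0 := by
    have := (hpt p).ne'
    rwa [hy] at this
  have e1 := hw 0 h0
  have e2 := hB 0 h0
  have e3 := hlog 0 h0
  rw [hp0, hy] at e1 e2 e3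
  have e4 := hA0 0 h0
  change _ = -(Real.exp (-(2 * chartExponent (neckFactor q he) p 0)) *
    (|neckBend (neckLength i) (Real.log (affineQuadratic v c P 0)
      - Real.log (affineQuadratic v (1 / 2) ((-q : UnitSphere n) : 𝔽) 0))| *
      (2 * (1 / 2 * c * (1 - inner ℝ ((-q : UnitSphere n) : 𝔽) P)) /
      (affineQuadratic v (1 / 2) ((-q : UnitSphere n) : 𝔽) 0 * affineQuadratic v c P 0))))
  rw [e3, e2, e1, hP, one_sub_inner_pole_invStereo, hc]
  set A := affineQuadratic v (1 / 2) ((-q : UnitSphere n) : 𝔽) 0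
  have e5 : Real.exp (-(2 * (neckExponent e y - Real.log A)))
      = Real.exp (-(2 * neckExponent e y)) * A ^ 2 := by
    rw [← Real.exp_log e4, ← Real.exp_nat_mul, ← Real.exp_add, Real.log_exp]
    congr 1
    push_cast
    ring
  rw [e5]
  field_simp
  ring

end NeckCurvature

/-! ### The integral of the negative part of the curvature -/

section Integral

lemma sigmaMinus_mem_Icc {n : ℕ} {M : Type*} [TopologicalSpace M]
    [ChartedSpace (EuclideanSpace ℝ (Fin n)) M] [IsManifold (𝓡 n) ∞ M] {g : SmoothMetric n M}
    {p : M} {b : ℝ} (hb : 0 ≤ b) (h : ∀ κ ∈ sectionalCurvaturesAt g p, -b ≤ κ) :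
    sigmaMinus g p ∈ Icc 0 b := by
  rw [sigmaMinus]
  split_ifs with h0
  · exact ⟨le_rfl, hb⟩
  · push Not at h0
    obtain ⟨κ, hκ, hκ0⟩ := h0
    refine ⟨?_, ?_⟩
    · linarith [csInf_le ⟨-b, h⟩ hκ]
    · linarith [le_csInf ⟨κ, hκ⟩ h]

/-- The function `t⁻ⁿ` on `[1, r]`, extended by zero. -/
def annulusWeight (n : ℕ) (r t : ℝ) : ℝ := (Icc 1 r).indicator (fun t => (t ^ n)⁻¹) t

lemma annulusWeight_nonneg (n : ℕ) (r t : ℝ) : 0 ≤ annulusWeight n r t :=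
  indicator_nonneg (fun _ ht => inv_nonneg.2 (pow_nonneg (zero_le_one.trans ht.1) n)) t

lemma measurable_annulusWeight (n : ℕ) (r : ℝ) : Measurable (annulusWeight n r) :=
  (measurable_id.pow_const n).inv.indicator measurableSet_Icc

variable {n : ℕ}

local notation "𝔼" => EuclideanSpace ℝ (Fin n)

lemma lintegral_annulusWeight (hn : 0 < n) {r : ℝ} (hr : 1 ≤ r) (z : 𝔼) :
    ∫⁻ y : 𝔼, ENNReal.ofReal (annulusWeight n r ‖y - z‖)
      = ENNReal.ofReal (n * volume.real (ball (0 : 𝔼) 1) * Real.log r) := by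
  have : Nonempty (Fin n) := ⟨⟨0, hn⟩⟩
  have : Nontrivial 𝔼 := inferInstance
  have h1 : ∀ t : ℝ, t ^ (n - 1) • annulusWeight n r t = (Icc 1 r).indicator (fun t => t⁻¹) t := by
    intro t
    by_cases ht : t ∈ Icc 1 r
    · have ht0 : t ≠ 0 := (zero_lt_one.trans_le ht.1).ne'
      rw [annulusWeight, indicator_of_mem ht, indicator_of_mem ht, smul_eq_mul]
      nth_rw 2 [← Nat.sub_add_cancel (show 1 ≤ n from hn)]
      rw [pow_succ]
      field_simp
    · rw [annulusWeight, indicator_of_notMem ht, indicator_of_notMem ht, smul_zero]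
  have h2 : IntegrableOn (fun t : ℝ => t⁻¹) (Icc 1 r) :=
    (continuousOn_id.inv₀ fun t ht => (zero_lt_one.trans_le ht.1).ne').integrableOn_Icc
  have h3 : Integrable (fun y : 𝔼 => annulusWeight n r ‖y‖) := by
    rw [integrable_fun_norm_addHaar, finrank_euclideanSpace_fin]
    simp only [h1]
    exact ((integrable_indicator_iff measurableSet_Icc).2 h2).integrableOn
  have h4 : ∫ y : 𝔼, annulusWeight n r ‖y‖ = n * volume.real (ball (0 : 𝔼) 1) * Real.log r := by
    rw [integral_fun_norm_addHaar, finrank_euclideanSpace_fin]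
    simp only [h1]
    have h5 : Ioi (0 : ℝ) ∩ Icc 1 r = Icc 1 r :=
      inter_eq_right.2 fun t ht => zero_lt_one.trans_le ht.1
    rw [setIntegral_indicator measurableSet_Icc, h5, integral_Icc_eq_integral_Ioc,
      ← intervalIntegral.integral_of_le hr, integral_inv_of_pos one_pos (one_pos.trans_le hr),
      div_one, nsmul_eq_mul, smul_eq_mul, mul_assoc]
  rw [lintegral_sub_right_eq_self (fun y : 𝔼 => ENNReal.ofReal (annulusWeight n r ‖y‖)) z,
    ← ofReal_integral_eq_lintegral_ofReal h3
      (Filter.Eventually.of_forall fun y => annulusWeight_nonneg n r _), h4]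

lemma sqrt_det_metricInChart_base (q : UnitSphere n) {e : 𝔼} (he : ‖e‖ = 1) {y : 𝔼}
    (hy : y ∈ (extChartAt (𝓡 n) (basePoint q he)).target) :
    Real.sqrt (metricInChart (neckMetric q he) (basePoint q he) y).det
      = Real.exp (n * neckExponent e y) := by
  rw [metricInChart_eq (neckMetric_inner q he) _ hy, chartExponent_base q he hy, Matrix.det_smul,
    Matrix.det_one, mul_one, Fintype.card_fin, ← Real.exp_nat_mul,
    Real.sqrt_eq_iff_mul_self_eq (Real.exp_pos _).le (Real.exp_pos _).le, ← Real.exp_add]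
  congr 1
  ring

/-- Under a conformal change, the factors of `σ₋^(n/2)` and of the volume cancel. -/
lemma exp_mul_rpow_mul_div {n : ℕ} {h b d : ℝ} (hb : 0 ≤ b) (hd : 0 < d) :
    Real.exp (n * h) * (Real.exp (-(2 * h)) * (b / d ^ 2)) ^ ((n : ℝ) / 2)
      = b ^ ((n : ℝ) / 2) * (d ^ n)⁻¹ := by
  have h1 : (d ^ 2) ^ ((n : ℝ) / 2) = d ^ n := by
    rw [← Real.rpow_natCast d 2, ← Real.rpow_mul hd.le, ← Real.rpow_natCast d n]
    congr 1
    push_cast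
    ring
  rw [Real.mul_rpow (Real.exp_pos _).le (by positivity), Real.div_rpow hb (by positivity), h1,
    ← Real.exp_mul, ← mul_assoc, ← Real.exp_add]
  have h2 : n * h + -(2 * h) * ((n : ℝ) / 2) = 0 := by ring
  rw [h2, Real.exp_zero, one_mul, div_eq_mul_inv]

/-- The quantity `σ₋(g)^(n/2) dvol_g` is scale invariant, and is bounded by a multiple of
`|y - z|⁻ⁿ dy` on an annulus around the end `z` of some neck. -/
lemma exp_mul_sigmaMinus_rpow_le (hn : 0 < n) (q : UnitSphere n) {e : 𝔼} (he : ‖e‖ = 1) {B : ℝ}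
    (hB0 : 0 < B) (hB : ∀ l t : ℝ, 0 < l → |neckBend l t| ≤ B / l) (x : (neckEnds q he).compl)
    {y : 𝔼} (hy : extChartAt (𝓡 n) (basePoint q he) x = y) :
    ∃ i, Real.exp (n * neckExponent e y) * sigmaMinus (neckMetric q he) x ^ ((n : ℝ) / 2)
      ≤ (4 * B / neckLength i) ^ ((n : ℝ) / 2) *
        annulusWeight n (neckRadius i) ‖y - neckCentre e i‖ := by
  obtain ⟨i, hi⟩ := exists_mem_neckRegion y
  refine ⟨i, ?_⟩
  have hn2 : 0 < (n : ℝ) / 2 := by positivity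
  have hL := neckLength_pos i
  have hd : 0 < ‖y - neckCentre e i‖ := by
    rw [← hy]
    exact norm_pos_iff.2 (sub_ne_zero.2 (extChartAt_base_ne q he x i))
  have hσ := sigmaMinus_mem_Icc (by positivity)
    fun κ hκ => le_of_mem_sectionalCurvaturesAt q he x hy hi (κ := κ) hκ
  by_cases hmem : ‖y - neckCentre e i‖ ∈ Icc 1 (neckRadius i)
  · have h1 : 4 * |neckBend (neckLength i) (Real.log (‖y - neckCentre e i‖ ^ 2))|
        ≤ 4 * B / neckLength i := by
      rw [mul_div_assoc]
      exact mul_le_mul_of_nonneg_left (hB _ _ hL) (by norm_num)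
    rw [annulusWeight, indicator_of_mem hmem, ← exp_mul_rpow_mul_div (by positivity) hd]
    refine mul_le_mul_of_nonneg_left (Real.rpow_le_rpow hσ.1 (hσ.2.trans ?_) hn2.le)
      (Real.exp_pos _).le
    gcongr
  -- Off the annulus the profile is affine, and the curvature is nonnegative.
  · have h1 : neckBend (neckLength i) (Real.log (‖y - neckCentre e i‖ ^ 2)) = 0 := by
      refine neckBend_of_notMem hL fun h => hmem ?_
      rw [Real.log_pow, Nat.cast_ofNat] at h
      refine ⟨(Real.log_nonneg_iff hd).1 (by linarith [h.1]), ?_⟩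
      exact (Real.log_le_iff_le_exp hd).1 (by linarith [h.2])
    rw [h1, abs_zero, mul_zero, zero_div, mul_zero] at hσ
    rw [le_antisymm hσ.2 hσ.1, Real.zero_rpow hn2.ne', mul_zero, annulusWeight,
      indicator_of_notMem hmem, mul_zero]

lemma rpow_mul_neckLength_le (hn : 3 ≤ n) {b : ℝ} (hb : 0 ≤ b) (i : ℕ) :
    (b / neckLength i) ^ ((n : ℝ) / 2) * neckLength i ≤ b ^ ((n : ℝ) / 2) * (1 / 2) ^ i := by
  have hL := neckLength_pos i
  have hn' : (3 : ℝ) ≤ n := by exact_mod_cast hn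
  have h1 : neckLength i ^ (1 - (n : ℝ) / 2) ≤ (1 / 2) ^ i := by
    have h2 : neckLength i ^ (-(1 / 2 : ℝ)) = (1 / 2) ^ (i + 1) := by
      have : neckLength i = ((2 : ℝ) ^ (i + 1)) ^ 2 := by
        rw [neckLength, ← pow_mul, mul_comm, pow_mul]
        norm_num
      rw [Real.rpow_neg hL.le, ← Real.sqrt_eq_rpow, this, Real.sqrt_sq (by positivity)]
      simp
    calc neckLength i ^ (1 - (n : ℝ) / 2) ≤ neckLength i ^ (-(1 / 2 : ℝ)) :=
          Real.rpow_le_rpow_of_exponent_le (by linarith [four_le_neckLength i]) (by linarith)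
      _ = (1 / 2) ^ (i + 1) := h2
      _ ≤ (1 / 2) ^ i := pow_le_pow_of_le_one (by norm_num) (by norm_num) (Nat.le_succ i)
  rw [Real.rpow_sub hL, Real.rpow_one] at h1
  rw [Real.div_rpow hb hL.le]
  calc _ = b ^ ((n : ℝ) / 2) * (neckLength i / neckLength i ^ ((n : ℝ) / 2)) := by ring
    _ ≤ _ := mul_le_mul_of_nonneg_left h1 (Real.rpow_nonneg hb _)

lemma lintegral_sigmaMinus_neckMetric_lt_top (hn : 3 ≤ n) (q : UnitSphere n) {e : 𝔼}
    (he : ‖e‖ = 1) :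
    ∫⁻ x, ENNReal.ofReal (sigmaMinus (neckMetric q he) x ^ ((n : ℝ) / 2))
      ∂(riemannianVolume (neckMetric q he)) < ⊤ := by
  classical
  obtain ⟨B, hB0, hB⟩ := exists_abs_neckBend_le
  set T := (extChartAt (𝓡 n) (basePoint q he)).target with hT
  have hTm : IsOpen T := isOpen_extChartAt_target _
  have hcont : ContinuousOn (fun y => ENNReal.ofReal (Real.exp (n * neckExponent e y))) T := by
    intro y hy
    have h1 := (contDiffAt_neckExponent he ((mem_base_target q he).1 hy)).continuousAt
    exact (ENNReal.continuous_ofReal.continuousAt.comp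
      (Real.continuous_exp.continuousAt.comp (continuousAt_const.mul h1))).continuousWithinAt
  set d : 𝔼 → ℝ≥0∞ :=
    T.piecewise (fun y => ENNReal.ofReal (Real.exp (n * neckExponent e y))) fun _ => 0 with hd
  have hdm : Measurable d := hcont.measurable_piecewise continuousOn_const hTm.measurableSet
  set C : ℝ := n * volume.real (ball (0 : 𝔼) 1) with hC
  have hC0 : 0 ≤ C := by positivity
  set K : ℝ := C / 2 * (4 * B) ^ ((n : ℝ) / 2) with hK
  set W : ℕ → 𝔼 → ℝ≥0∞ := fun i y => ENNReal.ofReal ((4 * B / neckLength i) ^ ((n : ℝ) / 2)) *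
    ENNReal.ofReal (annulusWeight n (neckRadius i) ‖y - neckCentre e i‖) with hW
  have hWm : ∀ i, Measurable fun y : 𝔼 =>
      ENNReal.ofReal (annulusWeight n (neckRadius i) ‖y - neckCentre e i‖) := fun i =>
    ((measurable_annulusWeight n _).comp (measurable_id.sub_const _).norm).ennreal_ofReal
  have hWi : ∀ i, ∫⁻ y, W i y ≤ ENNReal.ofReal (K * (1 / 2) ^ i) := by
    intro i
    rw [lintegral_const_mul _ (hWm i),
      lintegral_annulusWeight (by lia : 0 < n) (one_le_neckRadius i),
      ← ENNReal.ofReal_mul (by have := neckLength_pos i; positivity)]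
    refine ENNReal.ofReal_le_ofReal ?_
    rw [neckRadius, Real.log_exp, ← hC]
    calc _ = C / 2 * ((4 * B / neckLength i) ^ ((n : ℝ) / 2) * neckLength i) := by ring
      _ ≤ C / 2 * ((4 * B) ^ ((n : ℝ) / 2) * (1 / 2) ^ i) :=
        mul_le_mul_of_nonneg_left (rpow_mul_neckLength_le hn (by positivity) i) (by positivity)
      _ = _ := by ring
  -- Each point is charged to the neck of its own region; the sum over all necks is an upper bound.
  calc _ ≤ ∫⁻ y in T, d y * ENNReal.ofReal (sigmaMinus (neckMetric q he)
          ((extChartAt (𝓡 n) (basePoint q he)).symm y) ^ ((n : ℝ) / 2)) := by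
        refine lintegral_riemannianVolume_le _ (basePoint q he) (base_source_eq q he) hdm ?_ _
        intro y hy
        rw [sqrt_det_metricInChart_base q he hy, hd, piecewise_eq_of_mem _ _ _ hy]
    _ ≤ ∫⁻ y in T, ∑' i, W i y := by
        refine setLIntegral_mono' hTm.measurableSet fun y hy => ?_
        rw [hd, piecewise_eq_of_mem _ _ _ hy, ← ENNReal.ofReal_mul (Real.exp_pos _).le]
        obtain ⟨i, hi⟩ := exp_mul_sigmaMinus_rpow_le (by lia) q he hB0 hB
          ((extChartAt (𝓡 n) (basePoint q he)).symm y)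
          ((extChartAt (𝓡 n) (basePoint q he)).right_inv hy)
        refine (ENNReal.ofReal_le_ofReal hi).trans ?_
        rw [ENNReal.ofReal_mul (by have := neckLength_pos i; positivity)]
        exact ENNReal.le_tsum (f := fun i => W i y) i
    _ ≤ ∫⁻ y, ∑' i, W i y := setLIntegral_le_lintegral _ _
    _ = ∑' i, ∫⁻ y, W i y := lintegral_tsum fun i => ((hWm i).const_mul _).aemeasurable
    _ ≤ ∑' i, ENNReal.ofReal (K * (1 / 2) ^ i) := ENNReal.tsum_le_tsum hWi
    _ = ENNReal.ofReal (∑' i : ℕ, K * (1 / 2) ^ i) :=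
        (ENNReal.ofReal_tsum_of_nonneg (fun i => by positivity)
          (summable_geometric_two.mul_left K)).symm
    _ < ⊤ := ENNReal.ofReal_lt_top

lemma sectionalCurvatureBoundedBelow_neckMetric (q : UnitSphere n) {e : 𝔼} (he : ‖e‖ = 1) :
    SectionalCurvatureBoundedBelow (neckMetric q he) := by
  obtain ⟨B, hB0, hB⟩ := exists_abs_neckBend_le
  refine ⟨-(4 * B), fun p κ hκ => ?_⟩
  obtain ⟨y, hy⟩ : ∃ y, extChartAt (𝓡 n) (basePoint q he) p = y := ⟨_, rfl⟩
  obtain ⟨i, hi⟩ := exists_mem_neckRegion y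
  have hd : 0 < ‖y - neckCentre e i‖ := by
    rw [← hy]
    exact norm_pos_iff.2 (sub_ne_zero.2 (extChartAt_base_ne q he p i))
  refine le_trans (neg_le_neg ?_) (le_of_mem_sectionalCurvaturesAt q he p hy hi hκ)
  have h1 : Real.exp (-(2 * neckExponent e y)) ≤ ‖y - neckCentre e i‖ ^ 2 := by
    rw [← Real.le_log_iff_exp_le (by positivity), Real.log_pow, Nat.cast_ofNat]
    linarith [neg_log_dist_le_neckExponent he i y]
  have h2 : |neckBend (neckLength i) (Real.log (‖y - neckCentre e i‖ ^ 2))| ≤ B := by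
    refine (hB _ _ (neckLength_pos i)).trans (div_le_self hB0.le ?_)
    linarith [four_le_neckLength i]
  calc _ ≤ ‖y - neckCentre e i‖ ^ 2 * (4 * B / ‖y - neckCentre e i‖ ^ 2) := by gcongr
    _ = 4 * B := by field_simp

end Integral

end RiemGeom


theorem mainTheorem4 (n : ℕ) (hn : 3 ≤ n) :
    ∃ (S : TopologicalSpace.Closeds (RiemGeom.UnitSphere n))
      (f : S.compl → ℝ) (g : RiemGeom.SmoothMetric n S.compl),
      (S : Set (RiemGeom.UnitSphere n)).Infinite ∧
      IsConnected (S : Set (RiemGeom.UnitSphere n))ᶜ ∧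
      ContMDiff (𝓡 n) 𝓘(ℝ, ℝ) ∞ f ∧
      (∀ (x : S.compl) (u v : TangentSpace (𝓡 n) x),
        g.inner x u v = Real.exp (2 * f x) * RiemGeom.roundMetric S.compl x u v) ∧
      RiemGeom.IsCompleteMetric g ∧
      RiemGeom.SectionalCurvatureBoundedBelow g ∧
      ∫⁻ x, ENNReal.ofReal (RiemGeom.sigmaMinus g x ^ ((n : ℝ) / 2))
        ∂(RiemGeom.riemannianVolume g) < ⊤ := by
  have q : RiemGeom.UnitSphere n := ⟨EuclideanSpace.single 0 1, by simp⟩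
  have he : ‖(EuclideanSpace.single ⟨0, by lia⟩ 1 : EuclideanSpace ℝ (Fin n))‖ = 1 := by simp
  exact ⟨RiemGeom.neckEnds q he, RiemGeom.neckFactor q he, RiemGeom.neckMetric q he,
    RiemGeom.infinite_neckEnds q he, RiemGeom.isConnected_compl_neckEnds hn q he,
    RiemGeom.contMDiff_neckFactor q he, RiemGeom.neckMetric_inner q he,
    RiemGeom.isCompleteMetric_neckMetric q he,
    RiemGeom.sectionalCurvatureBoundedBelow_neckMetric q he,
    RiemGeom.lintegral_sigmaMinus_neckMetric_lt_top hn q he⟩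

end
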